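/- **Unending first-price auction without bidder uncertainty.** In every round $t=0,1,2,\dots$ one item is sold by a first-price auction among the bidders currently in a pool. The winner (highest bid; equal bids are tie-broken by value) pays her bid and leaves; nobody else is ever removed ($\delta=0$); then a Poisson number, with mean $\lambda$, of new bidders joins the pool. Bidders have unit demand and constant private values, drawn independently (of each other and of the arrival numbers) from an atomless distribution on $[0,\infty)$ with c.d.f. $F$. The pool at round $0$ is an arbitrary finite pool. A bidder's utility is her value minus her bid in the round that she wins, and $0$ if she never wins. Bids are nonnegative; a bid may depend on whatever bidders observe (nothing, or announced prices, or any other information structure). A *steady-state symmetric equilibrium* is a nonnegative, weakly increasing, piecewise differentiable function $b$ on $[0,\infty)$ such that, when all bidders bid $b(\text{value})$ in every round, no bidder can gain by changing her bid in any or all rounds, in the limit as the auction settles: for every $x\ge 0$ and $\varepsilon>0$ there is $T_0$ such that for every $T\ge T_0$ a bidder of value $x$ who enters the pool at round $T$ cannot raise her expected utility by more than $\varepsilon$ by any bidding strategy, compared with bidding $b(x)$ in every round. **Theorem (Bidding without Uncertainty).** Let $\lambda>1$ and let $X_{(\lambda)}$ be the unique value with $F(X_{(\lambda)})=\frac{\lambda-1}{\lambda}$.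 Then $$b^*(x)=\begin{cases}x & x<X_{(\lambda)}\\ X_{(\lambda)} & x\ge X_{(\lambda)}\end{cases}$$ is a steady-state symmetric equilibrium. Moreover, for every steady-state symmetric equilibrium $b$ (in particular for $b^*$): 1. $b(x)=X_{(\lambda)}$ for every $x>X_{(\lambda)}$, and $b(x)\to X_{(\lambda)}$ as $x\uparrow X_{(\lambda)}$; if $b$ is individually rational ($b(x)\le x$ for all $x \ge 0$), then $b\le b^*$ on $[0,\infty)$, so that $b^*$ is the greatest individually rational equilibrium. 2. (Posted-price mechanism.) A bidder with value $x>X_{(\lambda)}$ who enters at any round and bids $b(x)$ almost surely wins an item, and so buys it at the price $X_{(\lambda)}$. For a bidder with value $x<X_{(\lambda)}$ who enters at round $T$ and bids $b(x)$, the probability of ever winning an item tends to $0$ as $T\to\infty$. 3. (Price.) The probability that the item of round $t$ is sold at the price $X_{(\lambda)}$ tends to $1$ as $t\to\infty$. -/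

import Mathlib

open MeasureTheory ProbabilityTheory Filter Topology Set
open scoped NNReal ENNReal

noncomputable section

namespace UnendingAuction

variable {Ω : Type*} [MeasurableSpace Ω]

/-- The arrivals of an unending auction on a probability space `(Ω, P)`. After round `t`, a
number `count t` of new bidders joins the pool, and the `k`-th of them has private value
`value t k`. The numbers are Poisson with mean `lam`, the values have law `μ`, and all of them
are mutually independent. -/
structure Arrivals (P : Measure Ω) (lam : ℝ≥0) (μ : Measure ℝ) where
  count : ℕ → Ω → ℕ
  value : ℕ → ℕ → Ω → ℝ
  measurable_count : ∀ t, Measurable (count t)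
  measurable_value : ∀ t k, Measurable (value t k)
  law_count : ∀ t, P.map (count t) = poissonMeasure lam
  law_value : ∀ t k, P.map (value t k) = μ
  indep_count : iIndepFun count P
  indep_value : iIndepFun (fun (p : ℕ × ℕ) (ω : Ω) => value p.1 p.2 ω) P
  indep_count_value :
    IndepFun (fun (ω : Ω) (t : ℕ) => count t ω) (fun (ω : Ω) (p : ℕ × ℕ) => value p.1 p.2 ω) P

/-- The value of the bidder who wins a round when the bidders in the pool have the listed values
and a bidder with value `v` bids `b v`: the bid is highest, equal bids are tie-broken by value.
There is no winner if the pool is empty. -/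
def winner (b : ℝ → ℝ) (l : List ℝ) : Option ℝ :=
  l.argmax fun v => toLex (b v, v)

/-- The pool after the winner has left it. -/
def afterSale (b : ℝ → ℝ) (l : List ℝ) : List ℝ :=
  match winner b l with
  | none => l
  | some v => l.erase v

variable {P : Measure Ω} {lam : ℝ≥0} {μ : Measure ℝ}

namespace Arrivals

variable (A : Arrivals P lam μ)

/-- The values of the bidders who arrive after round `t`. -/
def batch (t : ℕ) (ω : Ω) : List ℝ :=
  (List.range (A.count t ω)).map fun k => A.value t k ω

/-- The values of the bidders in the pool at round `t`, when the pool at round `0` is `pool₀` and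
everybody bids `b`: each round the winner leaves, nobody else is removed (there is no bidder
uncertainty), and then the new bidders arrive. -/
def pool (pool₀ : List ℝ) (b : ℝ → ℝ) : ℕ → Ω → List ℝ
  | 0, _ => pool₀
  | t + 1, ω => afterSale b (pool pool₀ b t ω) ++ A.batch t ω

/-- The price paid in round `t`: the bid of the winner (`none` if there is no bidder). -/
def price (pool₀ : List ℝ) (b : ℝ → ℝ) (t : ℕ) (ω : Ω) : Option ℝ :=
  (winner b (A.pool pool₀ b t ω)).map b

/-- An additional bidder with value `x` who bids `β t ω` in round `t` outbids all other bidders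
of the pool in round `t`, where the others bid `b`. Until she wins, the others win and leave as
they would without her, so that they form the pool `A.pool pool₀ b t ω`. -/
def Outbids (pool₀ : List ℝ) (b : ℝ → ℝ) (x : ℝ) (β : ℕ → Ω → ℝ) (t : ℕ) (ω : Ω) : Prop :=
  ∀ v ∈ A.pool pool₀ b t ω, b v < β t ω ∨ (b v = β t ω ∧ v < x)

/-- A bidder with value `x` who enters the pool at round `T` and bids `β` wins some round. -/
def Wins (pool₀ : List ℝ) (b : ℝ → ℝ) (x : ℝ) (T : ℕ) (β : ℕ → Ω → ℝ) (ω : Ω) : Prop :=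
  ∃ t, T ≤ t ∧ A.Outbids pool₀ b x β t ω

open Classical in
/-- The utility of a bidder with value `x` who enters the pool at round `T`, bids `β`, and leaves
with the first item that she wins: her value minus her bid in the round that she wins, and `0`
if she never wins. -/
def utility (pool₀ : List ℝ) (b : ℝ → ℝ) (x : ℝ) (T : ℕ) (β : ℕ → Ω → ℝ) (ω : Ω) : ℝ :=
  if h : A.Wins pool₀ b x T β ω then x - β (Nat.find h) ω else 0

/-- The (possibly deviating) bidding strategies of a bidder with value `x` who enters at round
`T`: nonnegative bids, the bid in round `t` depending on what is observed by then (the σ-algebra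
`info t`), of finite expected utility. As the utility is at most `x`, a strategy whose utility is
not integrable has expected utility `-∞`, so nothing is lost by leaving it out. -/
structure IsStrategy (pool₀ : List ℝ) (info : ℕ → MeasurableSpace Ω) (b : ℝ → ℝ) (x : ℝ) (T : ℕ)
    (β : ℕ → Ω → ℝ) : Prop where
  nonneg : ∀ t ω, 0 ≤ β t ω
  adapted : ∀ t, Measurable[info t] (β t)
  integrable : Integrable (A.utility pool₀ b x T β) P

/-- `b` is a symmetric equilibrium in the steady state. It is a nonnegative, weakly increasing,
piecewise differentiable function of the value. When everybody bids `b` consistently and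
repeatedly, no bidder can improve her expected utility by changing her bid in any or all rounds,
in the limit as the auction settles: for a bidder who enters at round `T`, the largest possible
gain vanishes as `T → ∞`. -/
structure IsSteadyStateEquilibrium (pool₀ : List ℝ) (info : ℕ → MeasurableSpace Ω)
    (b : ℝ → ℝ) : Prop where
  nonneg : ∀ x, 0 ≤ x → 0 ≤ b x
  monotone : MonotoneOn b (Ici 0)
  piecewise_differentiable : ∀ K : ℝ, {x ∈ Icc 0 K | ¬ DifferentiableAt ℝ b x}.Finite
  no_gain : ∀ x, 0 ≤ x → ∀ ε > 0, ∃ T₀ : ℕ, ∀ T ≥ T₀, ∀ β, A.IsStrategy pool₀ info b x T β →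
    ∫ ω, A.utility pool₀ b x T β ω ∂P ≤ ∫ ω, A.utility pool₀ b x T (fun _ _ => b x) ω ∂P + ε

end Arrivals

/-- Bid your value below `p`, and bid `p` above it. -/
def postedPriceBid (p : ℝ) (x : ℝ) : ℝ :=
  if x < p then x else p

end UnendingAuction

end

/-! ### Pathwise bounds for a queue with one service per round. -/

namespace UnendingAuction

/-! Fix an upper set `U` of values. Under weakly increasing bids with ties broken by value, the
winner always has the highest value in the pool, so one bidder with value in `U` leaves in each
round in which there is one. The number of such bidders is therefore a queue with one service per
round and i.i.d. input of mean `lam * μ U`, and it does not depend on the bidding function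
(`countP_pool`). Everything reduces to three facts about this queue. With mean input above 1 it is
eventually never empty (strong law). With mean at most 1 it is empty infinitely often (strong law
below 1, a martingale argument at 1). With mean exactly 1 the probability of being empty still tends
to 0.

The value `q` is where `lam * μ (Ici y)` crosses 1. Bidders above `q` win almost surely; those below
`q` win with vanishing probability.

Posted-price bidding is an equilibrium because a bid below `q - ε / 2` can win only when nobody of
value at least `q - ε / 2` is present, which late in the auction is improbable; so winning yields
essentially at most `x - q`.

Conversely, in any equilibrium all types above `q` win surely, hence bid the same, as each could
imitate a lower one. The common bid is at most every `y > q`, since bidding 0 never loses money. It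
is at least `q`, since otherwise a type just below `q` could overbid it, win surely and profit. The
same deviation forces the left limit at `q`. Finally, the queue of types above `q` is critical, so
such a type is present, wins and pays `q` with probability tending to 1. -/

/-- The length of a queue that starts with `n₀` customers, serves one customer per round, and is
then joined by `a t` new customers. -/
def queue (n₀ : ℕ) (a : ℕ → ℕ) : ℕ → ℕ
  | 0 => n₀
  | t + 1 => queue n₀ a t - 1 + a t

/-- The random walk with increments `a t - 1`. -/
def netInput (a : ℕ → ℕ) (t : ℕ) : ℝ := ∑ s ∈ Finset.range t, ((a s : ℝ) - 1)

lemma netInput_succ (a : ℕ → ℕ) (t : ℕ) : netInput a (t + 1) = netInput a t + ((a t : ℝ) - 1) := by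
  simp only [netInput, Finset.sum_range_succ]

lemma netInput_eq_sub (a : ℕ → ℕ) (t : ℕ) :
    netInput a t = ∑ s ∈ Finset.range t, (a s : ℝ) - t := by
  simp [netInput, Finset.sum_sub_distrib]

lemma queue_succ_eq (n₀ : ℕ) (a : ℕ → ℕ) (t : ℕ) :
    (queue n₀ a (t + 1) : ℝ)
      = queue n₀ a t + ((a t : ℝ) - 1) + if queue n₀ a t = 0 then 1 else 0 := by
  rcases Nat.eq_zero_or_pos (queue n₀ a t) with h | h
  · simp [queue, h]
  · rw [queue, if_neg h.ne']
    push_cast [Nat.cast_sub h]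
    ring

/-- The queue length is the net input plus the number of idle rounds. -/
lemma queue_eq_netInput_add (n₀ : ℕ) (a : ℕ → ℕ) (t : ℕ) :
    (queue n₀ a t : ℝ) = n₀ + netInput a t
      + ∑ s ∈ Finset.range t, if queue n₀ a s = 0 then (1 : ℝ) else 0 := by
  induction t with
  | zero => simp [queue, netInput]
  | succ t ih => rw [queue_succ_eq, ih, netInput_succ, Finset.sum_range_succ]; ring

lemma netInput_le_queue (n₀ : ℕ) (a : ℕ → ℕ) (t : ℕ) : netInput a t ≤ queue n₀ a t := by
  rw [queue_eq_netInput_add]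
  have : 0 ≤ ∑ s ∈ Finset.range t, if queue n₀ a s = 0 then (1 : ℝ) else 0 :=
    Finset.sum_nonneg fun s _ => by split_ifs <;> norm_num
  have : (0 : ℝ) ≤ n₀ := n₀.cast_nonneg
  linarith

/-- Busy rounds do not change the gap between queue and walk. At an idle round the queue is 0 and
the walk is at least `-m`, so the gap is at most `m` before the round and `m + 1` after it. -/
lemma queue_le_of_neg_le_netInput {n₀ : ℕ} {a : ℕ → ℕ} {m : ℝ} (hm : 0 ≤ m) (t : ℕ)
    (h : ∀ s < t, -m ≤ netInput a s) : (queue n₀ a t : ℝ) ≤ n₀ + 1 + m + netInput a t := by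
  induction t with
  | zero => simp [queue, netInput]; linarith
  | succ t ih =>
    have ih' := ih fun s hs => h s (hs.trans t.lt_succ_self)
    have ht := h t t.lt_succ_self
    have hn : (0 : ℝ) ≤ n₀ := n₀.cast_nonneg
    rw [queue_succ_eq, netInput_succ]
    split_ifs with h0
    · rw [h0]; push_cast; linarith
    · linarith

lemma idle_le_of_neg_le_netInput {n₀ : ℕ} {a : ℕ → ℕ} {m : ℝ} (hm : 0 ≤ m) (t : ℕ)
    (h : ∀ s < t, -m ≤ netInput a s) :
    ∑ s ∈ Finset.range t, (if queue n₀ a s = 0 then (1 : ℝ) else 0) ≤ 1 + m := by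
  have h1 := queue_le_of_neg_le_netInput (n₀ := n₀) hm t h
  rw [queue_eq_netInput_add] at h1
  linarith

lemma queue_mono {n m : ℕ} (h : n ≤ m) (a : ℕ → ℕ) (t : ℕ) : queue n a t ≤ queue m a t := by
  induction t with
  | zero => exact h
  | succ t ih => simp only [queue]; omega

lemma queue_succ_shift (n₀ : ℕ) (a : ℕ → ℕ) (t : ℕ) :
    queue n₀ a (t + 1) = queue (n₀ - 1 + a 0) (fun s => a (s + 1)) t := by
  induction t with
  | zero => rfl
  | succ t ih => rw [queue, ih]; rfl

lemma queue_sub_netInput_of_pos {n₀ : ℕ} {a : ℕ → ℕ} {T : ℕ}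
    (h : ∀ t ≥ T, queue n₀ a t ≠ 0) (k : ℕ) :
    (queue n₀ a (T + k) : ℝ) = queue n₀ a T + netInput a (T + k) - netInput a T := by
  induction k with
  | zero => simp
  | succ k ih =>
    rw [← add_assoc, queue_succ_eq, if_neg (h _ (by omega)), ih, netInput_succ]; ring

/-- A queue that is never empty after `T` moves in parallel with the walk, so its nonnegativity
bounds the walk below after `T`; up to `T` the walk has fallen by at most 1 per step. -/
lemma exists_queue_eq_zero_of_not_bddBelow (n₀ : ℕ) {a : ℕ → ℕ}
    (h : ¬ BddBelow (range (netInput a))) (T : ℕ) : ∃ t ≥ T, queue n₀ a t = 0 := by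
  by_contra! hc
  refine h ⟨-(T + queue n₀ a T), ?_⟩
  rintro _ ⟨s, rfl⟩
  have hneg : ∀ s : ℕ, -(s : ℝ) ≤ netInput a s := fun s => by
    rw [netInput_eq_sub]
    have : (0 : ℝ) ≤ ∑ i ∈ Finset.range s, (a i : ℝ) := Finset.sum_nonneg fun i _ => by positivity
    linarith
  rcases le_total s T with hs | hs
  · have h1 : (s : ℝ) ≤ T := by exact_mod_cast hs
    have h2 : (0 : ℝ) ≤ queue n₀ a T := Nat.cast_nonneg _
    have := hneg s
    linarith
  · obtain ⟨k, rfl⟩ := Nat.exists_eq_add_of_le hs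
    have h1 := queue_sub_netInput_of_pos hc k
    have h2 : (0 : ℝ) ≤ queue n₀ a (T + k) := Nat.cast_nonneg _
    have := hneg T
    linarith

lemma eventually_queue_pos_of_tendsto (n₀ : ℕ) {a : ℕ → ℕ} {m : ℝ} (hm : 1 < m)
    (h : Tendsto (fun n : ℕ => (∑ s ∈ Finset.range n, (a s : ℝ)) / n) atTop (𝓝 m)) :
    ∀ᶠ t in atTop, 0 < queue n₀ a t := by
  filter_upwards [h.eventually_const_lt hm, eventually_gt_atTop 0] with t ht h0
  have h0' : (0 : ℝ) < t := by exact_mod_cast h0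
  rw [lt_div_iff₀ h0'] at ht
  have := netInput_le_queue n₀ a t
  rw [netInput_eq_sub] at this
  exact_mod_cast (by linarith : (0 : ℝ) < queue n₀ a t)

lemma not_bddBelow_netInput_of_tendsto {a : ℕ → ℕ} {m : ℝ} (hm : m < 1)
    (h : Tendsto (fun n : ℕ => (∑ s ∈ Finset.range n, (a s : ℝ)) / n) atTop (𝓝 m)) :
    ¬ BddBelow (range (netInput a)) := by
  have h1 : Tendsto (fun n : ℕ => ((∑ s ∈ Finset.range n, (a s : ℝ)) / n - 1) * n) atTop atBot :=
    (h.sub_const 1).neg_mul_atTop (by linarith) tendsto_natCast_atTop_atTop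
  refine not_bddBelow_of_tendsto_atBot (h1.congr' ?_)
  filter_upwards [eventually_gt_atTop 0] with t h0
  rw [netInput_eq_sub]
  field_simp

/-- When the input averages 1, the walk falls at most sublinearly, and the deepest fall controls the
number of idle rounds. -/
lemma tendsto_idle_div (n₀ : ℕ) {a : ℕ → ℕ}
    (h : Tendsto (fun n : ℕ => (∑ s ∈ Finset.range n, (a s : ℝ)) / n) atTop (𝓝 1)) :
    Tendsto (fun n : ℕ => (∑ s ∈ Finset.range n, (if queue n₀ a s = 0 then (1 : ℝ) else 0)) / n)
      atTop (𝓝 0) := by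
  have hnonneg : ∀ n : ℕ,
      0 ≤ (∑ s ∈ Finset.range n, (if queue n₀ a s = 0 then (1 : ℝ) else 0)) / n := fun n =>
    div_nonneg (Finset.sum_nonneg fun s _ => by split_ifs <;> norm_num) n.cast_nonneg
  refine tendsto_order.2 ⟨fun c hc => .of_forall fun n => hc.trans_le (hnonneg n), fun c hc => ?_⟩
  obtain ⟨N, hN⟩ := eventually_atTop.1 (h.eventually_const_lt (show 1 - c / 2 < 1 by linarith))
  have hlow : ∀ s, -(N + s * (c / 2)) ≤ netInput a s := by
    intro s
    rw [netInput_eq_sub]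
    have hs : (0 : ℝ) ≤ ∑ i ∈ Finset.range s, (a i : ℝ) := Finset.sum_nonneg fun i _ => by positivity
    rcases lt_or_ge s N with hsN | hsN
    · have : (s : ℝ) ≤ N := by exact_mod_cast hsN.le
      have : (0 : ℝ) ≤ s * (c / 2) := by positivity
      linarith
    · rcases Nat.eq_zero_or_pos s with rfl | h0
      · simp
      have h0' : (0 : ℝ) < s := by exact_mod_cast h0
      have := hN s hsN
      rw [lt_div_iff₀ h0'] at this
      have : (0 : ℝ) ≤ N := N.cast_nonneg
      nlinarith
  -- Beyond `M` the constant `1 + N` is less than `n * (c / 2)`, the other half of the allowance `n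
  -- * c`.
  obtain ⟨M, hM⟩ := exists_nat_gt ((1 + N) / (c / 2))
  filter_upwards [eventually_gt_atTop 0, eventually_ge_atTop M] with n h0 hn
  have h0' : (0 : ℝ) < n := by exact_mod_cast h0
  have hn' : (M : ℝ) ≤ n := by exact_mod_cast hn
  rw [div_lt_iff₀ (by positivity)] at hM
  rw [div_lt_iff₀ h0']
  have := idle_le_of_neg_le_netInput (n₀ := n₀) (a := a) (m := N + n * (c / 2)) (by positivity) n
    fun s hs => by
      have : (s : ℝ) ≤ n := by exact_mod_cast hs.le
      have := hlow s
      nlinarith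
  nlinarith

@[fun_prop]
lemma measurable_queue {Ω : Type*} [MeasurableSpace Ω] {X : ℕ → Ω → ℕ} (hX : ∀ t, Measurable (X t))
    (n₀ t : ℕ) : Measurable fun ω => queue n₀ (fun s => X s ω) t := by
  induction t with
  | zero => exact measurable_const
  | succ t ih => simp only [queue]; fun_prop

end UnendingAuction

/-! ### Queues with i.i.d. input: transience, recurrence and the critical case. -/

namespace UnendingAuction

section IidInput

variable {Ω : Type*} [MeasurableSpace Ω] {P : Measure Ω}

/-- A submartingale that starts at `0` and has increments at most `R` converges wherever it is
bounded above. -/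
lemma _root_.MeasureTheory.Submartingale.exists_tendsto_of_bddAbove_of_sub_le [IsFiniteMeasure P]
    {ℱ : Filtration ℕ ‹MeasurableSpace Ω›} {f : ℕ → Ω → ℝ} {R : ℝ≥0} (hf : Submartingale f ℱ P)
    (hf0 : f 0 = 0) (hbdd : ∀ ω i, f (i + 1) ω - f i ω ≤ R) :
    ∀ᵐ ω ∂P, BddAbove (range fun n => f n ω) → ∃ c, Tendsto (fun n => f n ω) atTop (𝓝 c) := by
  -- One step before the stopped time the process is still below `r`, so it overshoots by at most
  -- `R`.
  have hle : ∀ (r : ℕ) (i : ℕ) (ω : Ω), stoppedAbove f (r : ℝ) i ω ≤ r + R := by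
    intro r i ω
    rw [stoppedAbove, stoppedProcess]
    obtain ⟨p, hp⟩ := WithTop.ne_top_iff_exists.1
      (ne_top_of_le_ne_top WithTop.coe_ne_top (min_le_left (WithTop.some i) (leastGE f (r : ℝ) ω)))
    rw [← hp, WithTop.untopA, WithTop.untopD_coe]
    rcases p with _ | j
    · rw [hf0, Pi.zero_apply]
      positivity
    · have hlt : WithTop.some j < leastGE f (r : ℝ) ω :=
        lt_of_lt_of_le (WithTop.coe_lt_coe.2 j.lt_succ_self)
          (hp.le.trans (min_le_right (WithTop.some i) _))
      have hnot := notMem_of_lt_hittingAfter hlt (by simp)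
      rw [mem_Ici, not_le] at hnot
      have := hbdd ω j
      linarith
  have hconv : ∀ᵐ ω ∂P, ∀ r : ℕ, ∃ c, Tendsto (fun n => stoppedAbove f (r : ℝ) n ω) atTop (𝓝 c) := by
    refine ae_all_iff.2 fun r => ?_
    -- The upper bound `r + R` and a nonnegative mean (the process starts at 0) together bound the
    -- L¹ norm.
    refine Submartingale.exists_ae_tendsto_of_bdd (hf.stoppedAbove r)
      (R := (2 * P univ * ENNReal.ofReal (r + R)).toNNReal) fun n => ?_
    rw [ENNReal.coe_toNNReal (ENNReal.mul_ne_top (ENNReal.mul_ne_top (by simp)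
      (measure_ne_top P _)) ENNReal.ofReal_ne_top)]
    refine eLpNorm_one_le_of_le' ((hf.stoppedAbove r).integrable _) ?_ (.of_forall (hle r n))
    rw [← setIntegral_univ]
    refine le_trans ?_ ((hf.stoppedAbove r).setIntegral_le (Nat.zero_le n) MeasurableSet.univ)
    simp [stoppedAbove, stoppedProcess, hf0]
  filter_upwards [hconv] with ω hω hb
  obtain ⟨b, hb⟩ := hb
  -- A path bounded by `b < r` is never stopped at level `r`.
  obtain ⟨r, hr⟩ := exists_nat_gt b
  obtain ⟨c, hc⟩ := hω r
  refine ⟨c, hc.congr fun n => ?_⟩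
  have : leastGE f (r : ℝ) ω = ⊤ := by
    refine hittingAfter_eq_top_iff.2 fun j _ => ?_
    have := hb (mem_range_self j)
    simp only [mem_Ici, not_le]
    exact lt_of_le_of_lt this hr
  rw [stoppedAbove, stoppedProcess, this, min_eq_left le_top, WithTop.untopA, WithTop.untopD_coe]

/-- A sequence of independent and identically distributed natural numbers with mean `m`. -/
structure IsIidInput (P : Measure Ω) (X : ℕ → Ω → ℕ) (m : ℝ) : Prop where
  measurable : ∀ t, Measurable (X t)
  indep : iIndepFun X P
  law_eq : ∀ t, P.map (X t) = P.map (X 0)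
  integrable : Integrable (fun ω => (X 0 ω : ℝ)) P
  mean : ∫ ω, (X 0 ω : ℝ) ∂P = m

variable {X : ℕ → Ω → ℕ} {m : ℝ} (hX : IsIidInput P X m)

namespace IsIidInput

include hX

lemma identDistrib (t : ℕ) : IdentDistrib (X t) (X 0) P P :=
  ⟨(hX.measurable t).aemeasurable, (hX.measurable 0).aemeasurable, hX.law_eq t⟩

lemma strong_law (g : ℕ → ℝ) (hg : Integrable (fun ω => g (X 0 ω)) P) :
    ∀ᵐ ω ∂P, Tendsto (fun n : ℕ => (∑ s ∈ Finset.range n, g (X s ω)) / n) atTop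
      (𝓝 (∫ ω, g (X 0 ω) ∂P)) :=
  strong_law_ae_real (fun s ω => g (X s ω)) hg
    (fun _ _ hij => (hX.indep.indepFun hij).comp (φ := g) (ψ := g) .of_discrete .of_discrete)
    fun i => (hX.identDistrib i).comp (u := g) .of_discrete

lemma ae_tendsto_average :
    ∀ᵐ ω ∂P, Tendsto (fun n : ℕ => (∑ s ∈ Finset.range n, (X s ω : ℝ)) / n) atTop (𝓝 m) := by
  simpa only [hX.mean] using hX.strong_law (fun n => (n : ℝ)) hX.integrable

/-- The frequency of zeros converges to `P (X 0 = 0) > 0`, which finitely many zeros cannot produce.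
-/
lemma ae_frequently_eq_zero [IsProbabilityMeasure P] (h0 : P {ω | X 0 ω = 0} ≠ 0) :
    ∀ᵐ ω ∂P, ∃ᶠ t in atTop, X t ω = 0 := by
  have hm : MeasurableSet {ω | X 0 ω = 0} := hX.measurable 0 (measurableSet_singleton 0)
  have hg : (fun ω => ({0} : Set ℕ).indicator (fun _ => (1 : ℝ)) (X 0 ω))
      = {ω | X 0 ω = 0}.indicator fun _ => 1 := by
    ext ω; simp [indicator]
  have hlaw := hX.strong_law (({0} : Set ℕ).indicator fun _ => 1)
    (by rw [hg]; exact (integrable_const _).indicator hm)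
  rw [hg, integral_indicator_const _ hm, smul_eq_mul, mul_one] at hlaw
  filter_upwards [hlaw] with ω hω
  by_contra hc
  rw [not_frequently] at hc
  obtain ⟨N, hN⟩ := eventually_atTop.1 hc
  have hpos : 0 < P.real {ω | X 0 ω = 0} := ENNReal.toReal_pos h0 (measure_ne_top P _)
  refine hpos.ne' (tendsto_nhds_unique hω ?_)
  have hlim : Tendsto (fun n : ℕ => (N : ℝ) / n) atTop (𝓝 0) :=
    tendsto_const_nhds.div_atTop tendsto_natCast_atTop_atTop
  refine squeeze_zero (fun n => ?_) (fun n => ?_) hlim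
  · exact div_nonneg (Finset.sum_nonneg fun i _ => indicator_nonneg (by simp) _) n.cast_nonneg
  · gcongr
    have : ∀ s, ({0} : Set ℕ).indicator (fun _ => (1 : ℝ)) (X s ω) ≤ if s < N then 1 else 0 := by
      intro s
      split_ifs with hs
      · exact indicator_le_self' (by simp) _
      · rw [indicator_of_notMem]; simpa using hN s (by omega)
    calc ∑ s ∈ Finset.range n, ({0} : Set ℕ).indicator (fun _ => (1 : ℝ)) (X s ω)
        ≤ ∑ s ∈ Finset.range n, if s < N then (1 : ℝ) else 0 := Finset.sum_le_sum fun s _ => this s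
      _ = ((Finset.range n).filter (· < N)).card := by simp
      _ ≤ N := by
          have : ((Finset.range n).filter (· < N)).card ≤ (Finset.range N).card :=
            Finset.card_le_card fun s => by simp
          exact_mod_cast this.trans_eq (Finset.card_range N)

/-- A queue with mean input greater than `1` is eventually never empty. -/
lemma ae_eventually_queue_pos (hm : 1 < m) (n₀ : ℕ) :
    ∀ᵐ ω ∂P, ∀ᶠ t in atTop, 0 < queue n₀ (fun s => X s ω) t := by
  filter_upwards [hX.ae_tendsto_average] with ω hω
  exact eventually_queue_pos_of_tendsto n₀ hm hω

/-- The negated walk is a martingale with increments at most 1. If it were bounded above it would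
converge, so its increments would tend to 0; but each zero of the input makes an increment equal to
1, and there are infinitely many. -/
lemma ae_not_bddBelow_netInput_of_mean_eq_one [IsProbabilityMeasure P]
    (h0 : P {ω | X 0 ω = 0} ≠ 0) (hm : m = 1) :
    ∀ᵐ ω ∂P, ¬ BddBelow (range (netInput fun s => X s ω)) := by
  set Y : ℕ → Ω → ℝ := fun s ω => 1 - X s ω with hY
  have hYm : ∀ s, Measurable (Y s) := fun s =>
    measurable_const.sub (measurable_from_nat.comp (hX.measurable s))
  have hYi : iIndepFun Y P :=
    hX.indep.comp (fun _ (n : ℕ) => (1 - n : ℝ)) fun _ => .of_discrete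
  have hYs : ∀ s, StronglyMeasurable (Y s) := fun s => (hYm s).stronglyMeasurable
  have hYint : ∀ s, Integrable (Y s) P := fun s => (integrable_const _).sub
    (((hX.identDistrib s).comp (u := fun n : ℕ => (n : ℝ)) .of_discrete).integrable_iff.2
      hX.integrable)
  have hYmean : ∀ s, ∫ ω, Y s ω ∂P = 0 := fun s => by
    have h1 := ((hX.identDistrib s).comp (u := fun n : ℕ => (1 - n : ℝ)) .of_discrete).integral_eq
    simp only [Function.comp_def] at h1
    simp only [hY, h1]
    rw [integral_sub (integrable_const _) hX.integrable, hX.mean, hm]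
    simp
  -- Dropping `Y 0` makes `f` start at 0 and be adapted to the natural filtration without a shift.
  set f : ℕ → Ω → ℝ := fun n ω => ∑ s ∈ Finset.range n, Y (s + 1) ω with hf
  have hmart : Martingale f (Filtration.natural Y hYs) P := by
    refine martingale_of_condExp_sub_eq_zero_nat (fun n => ?_)
      (fun n => integrable_finsetSum _ fun s _ => hYint _) fun n => ?_
    · refine Finset.stronglyMeasurable_fun_sum _ fun s hs => ?_
      exact (Filtration.stronglyAdapted_natural hYs (s + 1)).mono
        ((Filtration.natural Y hYs).mono (Finset.mem_range.1 hs))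
    · have : f (n + 1) - f n = Y (n + 1) := by
        ext ω; simp [hf, Finset.sum_range_succ]
      rw [this]
      filter_upwards [hYi.condExp_natural_ae_eq_of_lt hYs n.lt_succ_self] with ω hω
      rw [hω, hYmean]; rfl
  filter_upwards [hmart.submartingale.exists_tendsto_of_bddAbove_of_sub_le (R := 1)
    (by simp [hf]; rfl) fun ω n => by simp only [hf, Finset.sum_range_succ, hY]; simp,
    hX.ae_frequently_eq_zero h0] with ω hω hfreq hb
  have hrel : ∀ n, f n ω = Y 0 ω * (-1) - netInput (fun s => X s ω) (n + 1) := by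
    intro n
    simp only [hf, hY, netInput, Finset.sum_range_succ' _ n, sub_add_eq_sub_sub]
    simp [Finset.sum_sub_distrib]
  obtain ⟨c, hc⟩ := hω <| by
    obtain ⟨B, hB⟩ := hb
    refine ⟨Y 0 ω * (-1) - B, ?_⟩
    rintro _ ⟨n, rfl⟩
    have := hB (mem_range_self (n + 1))
    simp only [hrel]
    linarith
  have hdiff : Tendsto (fun n => f (n + 1) ω - f n ω) atTop (𝓝 0) := by
    simpa using ((tendsto_add_atTop_iff_nat 1).2 hc).sub hc
  have hev := (tendsto_add_atTop_iff_nat 1 (f := fun n => Y n ω)).1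
    (by simpa [hf, Finset.sum_range_succ] using hdiff)
  obtain ⟨t, h1, h2⟩ := (hfreq.and_eventually (hev.eventually_lt_const one_pos)).exists
  simp [hY, h1] at h2

/-- A queue with mean input at most `1` is empty infinitely often. -/
lemma ae_exists_queue_eq_zero [IsProbabilityMeasure P] (h0 : P {ω | X 0 ω = 0} ≠ 0) (hm : m ≤ 1)
    (n₀ : ℕ) : ∀ᵐ ω ∂P, ∀ T, ∃ t ≥ T, queue n₀ (fun s => X s ω) t = 0 := by
  rcases hm.lt_or_eq with hm | hm
  · filter_upwards [hX.ae_tendsto_average] with ω hω T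
    exact exists_queue_eq_zero_of_not_bddBelow n₀ (not_bddBelow_netInput_of_tendsto hm hω) T
  · filter_upwards [hX.ae_not_bddBelow_netInput_of_mean_eq_one h0 hm] with ω hω T
    exact exists_queue_eq_zero_of_not_bddBelow n₀ hω T

lemma measurableSet_queue_eq_zero (n₀ t : ℕ) :
    MeasurableSet {ω | queue n₀ (fun s => X s ω) t = 0} :=
  measurable_queue hX.measurable n₀ t (measurableSet_singleton 0)

lemma measurableSet_exists_queue_eq_zero (n₀ T : ℕ) :
    MeasurableSet {ω | ∃ t ≥ T, queue n₀ (fun s => X s ω) t = 0} := by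
  simp only [ofPred_exists, ofPred_and]
  exact .iUnion fun t => (MeasurableSet.const _).inter (hX.measurableSet_queue_eq_zero n₀ t)

/-- The events decrease to "empty infinitely often", which is null. -/
lemma tendsto_measure_exists_queue_eq_zero [IsProbabilityMeasure P] (hm : 1 < m) (n₀ : ℕ) :
    Tendsto (fun T : ℕ => P {ω | ∃ t ≥ T, queue n₀ (fun s => X s ω) t = 0}) atTop (𝓝 0) := by
  have h := tendsto_measure_iInter_atTop (μ := P)
    (fun T => (hX.measurableSet_exists_queue_eq_zero n₀ T).nullMeasurableSet)
    (fun T T' h ω ⟨t, ht, h'⟩ => ⟨t, le_trans h ht, h'⟩) ⟨0, measure_ne_top P _⟩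
  rwa [measure_mono_null (fun ω hω => ?_) (ae_iff.1 (hX.ae_eventually_queue_pos hm n₀))] at h
  simp only [mem_iInter, mem_ofPred_eq] at hω ⊢
  intro hc
  obtain ⟨N, hN⟩ := eventually_atTop.1 hc
  obtain ⟨t, ht, h'⟩ := hω N
  exact (hN t ht).ne' h'

/-- After one round an initially empty queue is at least as long as an empty queue restarted on the
shifted input, and the shifted input has the same law. -/
lemma antitone_measure_queue_eq_zero :
    Antitone fun t : ℕ => P {ω | queue 0 (fun s => X s ω) t = 0} := by
  have := hX.indep.isProbabilityMeasure
  refine antitone_nat_of_succ_le fun t => ?_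
  have hshift : P.map (fun ω s => X (s + 1) ω) = P.map fun ω s => X s ω := by
    rw [hX.indep.map_fun_eq_infinitePi_map hX.measurable,
      (hX.indep.precomp (add_left_injective 1)).map_fun_eq_infinitePi_map
        fun s => hX.measurable (s + 1)]
    congr 1
    ext1 s
    rw [hX.law_eq s]
    exact hX.law_eq (s + 1)
  have hS : MeasurableSet {a : ℕ → ℕ | queue 0 a t = 0} :=
    measurable_queue (X := fun s (a : ℕ → ℕ) => a s) (fun s => measurable_pi_apply s) 0 t
      (measurableSet_singleton 0)
  calc P {ω | queue 0 (fun s => X s ω) (t + 1) = 0}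
      ≤ P ((fun ω s => X (s + 1) ω) ⁻¹' {a | queue 0 a t = 0}) := by
        refine measure_mono fun ω hω => ?_
        simp only [mem_ofPred_eq, queue_succ_shift, mem_preimage] at hω ⊢
        exact Nat.eq_zero_of_le_zero ((queue_mono (Nat.zero_le _) _ t).trans_eq hω)
    _ = P ((fun ω s => X s ω) ⁻¹' {a | queue 0 a t = 0}) := by
        rw [← Measure.map_apply (measurable_pi_lambda _ fun s => hX.measurable (s + 1)) hS, hshift,
          Measure.map_apply (measurable_pi_lambda _ hX.measurable) hS]

/-- The probability that a queue with mean input `1` is empty tends to `0`. -/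
lemma tendsto_measure_queue_eq_zero [IsProbabilityMeasure P] (hm : m = 1) (n₀ : ℕ) :
    Tendsto (fun t : ℕ => P {ω | queue n₀ (fun s => X s ω) t = 0}) atTop (𝓝 0) := by
  -- Started empty, the probability of being empty is decreasing in time, hence at most its Cesàro
  -- mean. That mean is the expected fraction of idle rounds, which vanishes by `tendsto_idle_div`
  -- and dominated convergence.
  have hreal : Tendsto (fun t : ℕ => P.real {ω | queue 0 (fun s => X s ω) t = 0}) atTop (𝓝 0) := by
    have hanti : Antitone fun t : ℕ => P.real {ω | queue 0 (fun s => X s ω) t = 0} := fun s t h =>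
      ENNReal.toReal_mono (measure_ne_top P _) (hX.antitone_measure_queue_eq_zero h)
    have hlim : Tendsto (fun n : ℕ => ∫ ω, (∑ s ∈ Finset.range n,
        (if queue 0 (fun s => X s ω) s = 0 then (1 : ℝ) else 0)) / n ∂P) atTop (𝓝 0) := by
      have hms : ∀ s, Measurable fun ω => if queue 0 (fun s => X s ω) s = 0 then (1 : ℝ) else 0 :=
        fun s => Measurable.ite (hX.measurableSet_queue_eq_zero 0 s) measurable_const
          measurable_const
      have := tendsto_integral_of_dominated_convergence (μ := P) (f := fun _ => (0 : ℝ))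
        (F := fun (n : ℕ) ω => (∑ s ∈ Finset.range n,
          (if queue 0 (fun s => X s ω) s = 0 then (1 : ℝ) else 0)) / n)
        (fun _ => 1) (fun n => ((Finset.measurable_fun_sum _ fun s _ => hms s).div_const
          _).aestronglyMeasurable) (integrable_const _) (fun n => .of_forall fun ω => ?_) ?_
      · simpa using this
      · rw [Real.norm_of_nonneg (div_nonneg (Finset.sum_nonneg fun s _ => by
          split_ifs <;> norm_num) n.cast_nonneg)]
        refine div_le_one_of_le₀ ?_ n.cast_nonneg
        calc _ ≤ ∑ s ∈ Finset.range n, (1 : ℝ) :=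
              Finset.sum_le_sum fun s _ => by split_ifs <;> norm_num
          _ = n := by simp
      · filter_upwards [hX.ae_tendsto_average] with ω hω
        exact tendsto_idle_div 0 (hm ▸ hω)
    -- The shift avoids division by zero at `n = 0`.
    rw [← tendsto_add_atTop_iff_nat 1] at hlim ⊢
    refine squeeze_zero (fun n => measureReal_nonneg) (fun n => ?_) hlim
    have hint : ∀ s, ∫ ω, (if queue 0 (fun s => X s ω) s = 0 then (1 : ℝ) else 0) ∂P
        = P.real {ω | queue 0 (fun s => X s ω) s = 0} := fun s => by
      rw [← integral_indicator_one (hX.measurableSet_queue_eq_zero 0 s)]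
      simp [indicator]
    rw [integral_div, integral_finsetSum _ fun s _ => ?_]
    · simp only [hint]
      rw [le_div_iff₀ (by positivity)]
      calc _ = ∑ s ∈ Finset.range (n + 1), P.real {ω | queue 0 (fun s => X s ω) (n + 1) = 0} := by
            simp; ring
        _ ≤ _ := Finset.sum_le_sum fun s hs => hanti (Finset.mem_range.1 hs).le
    · refine Integrable.of_bound (C := 1) (Measurable.ite (hX.measurableSet_queue_eq_zero 0 s)
        measurable_const measurable_const).aestronglyMeasurable (.of_forall fun ω => ?_)
      split_ifs <;> simp
  have h0 : Tendsto (fun t : ℕ => P {ω | queue 0 (fun s => X s ω) t = 0}) atTop (𝓝 0) := by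
    simpa [ofReal_measureReal] using ENNReal.tendsto_ofReal hreal
  refine tendsto_of_tendsto_of_tendsto_of_le_of_le tendsto_const_nhds h0 (fun _ => zero_le)
    fun t => measure_mono fun ω (hω : queue _ _ _ = 0) => ?_
  exact Nat.eq_zero_of_le_zero ((queue_mono (Nat.zero_le n₀) _ t).trans_eq hω)

end IsIidInput

end IidInput

end UnendingAuction

/-! ### Independence of pairs and rows; the Poisson mean. -/

namespace UnendingAuction

section Independence

variable {Ω : Type*} [MeasurableSpace Ω] {P : Measure Ω}

/-- Two independent families of independent random variables can be paired. -/
lemma _root_.ProbabilityTheory.iIndepFun.prodMk_of_indepFun {ι β γ : Type*} [MeasurableSpace β]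
    [MeasurableSpace γ] {X : ι → Ω → β} {Y : ι → Ω → γ} (hX : iIndepFun X P) (hY : iIndepFun Y P)
    (hXm : ∀ i, Measurable (X i)) (hYm : ∀ i, Measurable (Y i))
    (hXY : IndepFun (fun ω i => X i ω) (fun ω i => Y i ω) P) :
    iIndepFun (fun i ω => (X i ω, Y i ω)) P := by
  rw [iIndepFun_iff_iIndep]
  refine iIndepSets.iIndep (fun i => ((hXm i).prodMk (hYm i)).comap_le)
    -- Rectangles form a π-system generating the σ-algebra of the pair.
    (fun i => {s | ∃ S, MeasurableSet S ∧ ∃ T, MeasurableSet T ∧ s = X i ⁻¹' S ∩ Y i ⁻¹' T})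
    (fun i => ?_) (fun i => ?_) ?_
  · rintro _ ⟨S, hS, T, hT, rfl⟩ _ ⟨S', hS', T', hT', rfl⟩ -
    exact ⟨S ∩ S', hS.inter hS', T ∩ T', hT.inter hT', by ext; simp; tauto⟩
  · rw [← generateFrom_prod, MeasurableSpace.comap_generateFrom]
    congr 1
    ext s
    simp only [mem_image, mem_image2, mem_ofPred_eq]
    constructor
    · rintro ⟨_, ⟨S, hS, T, hT, rfl⟩, rfl⟩
      exact ⟨S, hS, T, hT, rfl⟩
    · rintro ⟨S, hS, T, hT, rfl⟩
      exact ⟨S ×ˢ T, ⟨S, hS, T, hT, rfl⟩, rfl⟩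
  · rw [iIndepSets_iff]
    intro s f hf
    have hf' : ∀ i, ∃ S : Set β, ∃ T : Set γ, MeasurableSet S ∧ MeasurableSet T ∧
        (i ∈ s → f i = X i ⁻¹' S ∩ Y i ⁻¹' T) := by
      intro i
      by_cases hi : i ∈ s
      · obtain ⟨S, hS, T, hT, h⟩ := hf i hi
        exact ⟨S, T, hS, hT, fun _ => h⟩
      · exact ⟨univ, univ, .univ, .univ, fun h => absurd h hi⟩
    choose S T hS hT h using hf'
    have hinter : (⋂ i ∈ s, f i)
        = (fun ω i => X i ω) ⁻¹' ((s : Set ι).pi S) ∩ (fun ω i => Y i ω) ⁻¹' ((s : Set ι).pi T) := by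
      rw [iInter₂_congr h]
      ext ω
      simp [Set.mem_pi, forall_and]
    have hpiX : (fun ω i => X i ω) ⁻¹' ((s : Set ι).pi S) = ⋂ i ∈ s, X i ⁻¹' S i := by
      ext; simp
    have hpiY : (fun ω i => Y i ω) ⁻¹' ((s : Set ι).pi T) = ⋂ i ∈ s, Y i ⁻¹' T i := by
      ext; simp
    rw [hinter, hXY.measure_inter_preimage_eq_mul _ _
      (MeasurableSet.pi s.countable_toSet fun i _ => hS i)
      (MeasurableSet.pi s.countable_toSet fun i _ => hT i), hpiX, hpiY,
      hX.measure_inter_preimage_eq_mul s fun i _ => hS i,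
      hY.measure_inter_preimage_eq_mul s fun i _ => hT i, ← Finset.prod_mul_distrib]
    refine Finset.prod_congr rfl fun i hi => ?_
    rw [h i hi]
    exact ((hXY.comp (measurable_pi_apply i) (measurable_pi_apply i)).measure_inter_preimage_eq_mul
      _ _ (hS i) (hT i)).symm

/-- The rows of a matrix of independent random variables are independent. -/
lemma _root_.ProbabilityTheory.iIndepFun.curry {ι κ β : Type*} [Countable ι] [Countable κ]
    [MeasurableSpace β]
    {V : ι → κ → Ω → β} (hV : iIndepFun (fun (p : ι × κ) ω => V p.1 p.2 ω) P)
    (hVm : ∀ i k, Measurable (V i k)) : iIndepFun (fun i ω k => V i k ω) P := by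
  have := hV.isProbabilityMeasure
  have hprob : ∀ i k, IsProbabilityMeasure (P.map (V i k)) := fun i k =>
    Measure.isProbabilityMeasure_map (hVm i k).aemeasurable
  have hrow : ∀ i, P.map (fun ω k => V i k ω) = Measure.infinitePi fun k => P.map (V i k) :=
    fun i => (hV.precomp (g := fun k : κ => (i, k))
      fun k l h => (Prod.mk.inj h).2).map_fun_eq_infinitePi_map (hVm i)
  rw [iIndepFun_iff_map_fun_eq_infinitePi_map fun i => measurable_pi_lambda _ (hVm i)]
  simp only [hrow]
  -- The whole array has a product law, and currying turns it into the product of the row laws.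
  rw [← Measure.infinitePi_map_curry (fun i k => P.map (V i k)),
    ← iIndepFun.map_fun_eq_infinitePi_map (X := fun (p : ι × κ) ω => V p.1 p.2 ω)
      (fun p => hVm p.1 p.2) hV, Measure.map_map (MeasurableEquiv.measurable _)
      (measurable_pi_lambda _ fun p : ι × κ => hVm p.1 p.2)]
  rfl

end Independence

/-- Since `n / n! = 1 / (n - 1)!`, an index shift turns the first moment into `r` times the total
mass. -/
lemma lintegral_natCast_poissonMeasure (r : ℝ≥0) : ∫⁻ n, (n : ℝ≥0∞) ∂poissonMeasure r = r := by
  have hsum : HasSum (fun n : ℕ => Real.exp (-r) * r ^ n / n.factorial * (n : ℝ)) r := by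
    have h := (hasSum_one_poissonMeasure r).mul_right (r : ℝ)
    rw [one_mul] at h
    refine (hasSum_nat_add_iff' 1).1 ?_
    rw [Finset.sum_range_one, Nat.cast_zero, mul_zero, sub_zero]
    have e : ∀ n : ℕ, Real.exp (-r) * r ^ (n + 1) / (n + 1).factorial * ((n + 1 : ℕ) : ℝ)
        = Real.exp (-r) * r ^ n / n.factorial * r := fun n => by
      rw [Nat.factorial_succ, pow_succ]
      push_cast
      field_simp
    simpa only [e] using h
  have hint : Integrable (fun n : ℕ => (n : ℝ)) (poissonMeasure r) := by
    rw [integrable_poissonMeasure_iff]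
    simpa using hsum.summable
  have hval : ∫ n, (n : ℝ) ∂poissonMeasure r = r := by
    rw [integral_poissonMeasure]
    simpa using hsum.tsum_eq
  have := ofReal_integral_eq_lintegral_ofReal hint (.of_forall fun n => n.cast_nonneg)
  rw [hval] at this
  simpa using this.symm

lemma countP_range_eq_sum (p : ℕ → Bool) (n : ℕ) :
    (List.range n).countP p = ∑ k ∈ Finset.range n, if p k then 1 else 0 := by
  induction n with
  | zero => simp
  | succ n ih =>
    simp only [List.range_succ, List.countP_append, ih, Finset.sum_range_succ]
    simp [List.countP_cons]

/-! ### The entrants with values in a given set, as i.i.d. queue input. -/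

namespace Arrivals

variable {Ω : Type*} [MeasurableSpace Ω] {P : Measure Ω} {lam : ℝ≥0} {μ : Measure ℝ}
  (A : Arrivals P lam μ)

open Classical in
/-- The number of bidders with a value in `U` who arrive after round `t`. -/
noncomputable def entrants (U : Set ℝ) (t : ℕ) (ω : Ω) : ℕ := (A.batch t ω).countP (· ∈ U)

open Classical in
/-- The number of the first `z.1` members of the sequence `z.2` that lie in `U`. -/
noncomputable def countIn (U : Set ℝ) (z : ℕ × (ℕ → ℝ)) : ℕ :=
  (List.range z.1).countP (fun k => z.2 k ∈ U)

open Classical in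
lemma countIn_eq_sum (U : Set ℝ) (z : ℕ × (ℕ → ℝ)) :
    countIn U z = ∑ k ∈ Finset.range z.1, if z.2 k ∈ U then 1 else 0 := by
  simp [countIn, countP_range_eq_sum]

lemma measurable_countIn {U : Set ℝ} (hU : MeasurableSet U) : Measurable (countIn U) := by
  classical
  refine measurable_from_prod_countable_right fun n => ?_
  simp only [countIn_eq_sum]
  exact Finset.measurable_fun_sum _ fun k _ =>
    Measurable.ite (measurable_pi_apply k hU) measurable_const measurable_const

lemma entrants_eq_countIn (U : Set ℝ) (t : ℕ) :
    A.entrants U t = countIn U ∘ fun ω => (A.count t ω, fun k => A.value t k ω) := by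
  ext ω
  simp [entrants, countIn, batch, List.countP_map, Function.comp_def]

lemma measurable_countValue (t : ℕ) :
    Measurable fun ω => (A.count t ω, fun k => A.value t k ω) :=
  (A.measurable_count t).prodMk (measurable_pi_lambda _ (A.measurable_value t))

lemma measurable_entrants {U : Set ℝ} (hU : MeasurableSet U) (t : ℕ) :
    Measurable (A.entrants U t) := by
  rw [entrants_eq_countIn]
  exact (measurable_countIn hU).comp (A.measurable_countValue t)

/-- Each term is one fixed function of the count and the row of values of its round, and these pairs
are independent across rounds. -/
lemma iIndepFun_entrants {U : Set ℝ} (hU : MeasurableSet U) : iIndepFun (A.entrants U) P := by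
  have hrows := A.indep_value.curry A.measurable_value
  have h := A.indep_count.prodMk_of_indepFun hrows A.measurable_count
    (fun t => measurable_pi_lambda _ (A.measurable_value t))
    (A.indep_count_value.comp measurable_id
      (ψ := fun (x : ℕ × ℕ → ℝ) (t k : ℕ) => x (t, k)) (by fun_prop))
  have h2 := h.comp (fun _ => countIn U) fun _ => measurable_countIn hU
  convert h2 using 2 with t
  exact A.entrants_eq_countIn U t

lemma indepFun_count_value (t : ℕ) :
    IndepFun (A.count t) (fun ω k => A.value t k ω) P :=
  A.indep_count_value.comp (φ := fun c : ℕ → ℕ => c t) (ψ := fun (x : ℕ × ℕ → ℝ) (k : ℕ) => x (t, k))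
    (measurable_pi_apply t) (by fun_prop)

lemma map_countValue [IsProbabilityMeasure P] [IsProbabilityMeasure μ] (t : ℕ) :
    P.map (fun ω => (A.count t ω, fun k => A.value t k ω))
      = (poissonMeasure lam).prod (Measure.infinitePi fun _ => μ) := by
  rw [(A.indepFun_count_value t).map_prod_eq_prod_map_map (A.measurable_count t).aemeasurable
    (measurable_pi_lambda _ (A.measurable_value t)).aemeasurable, A.law_count t,
    (A.indep_value.precomp (g := fun k : ℕ => (t, k))
      fun k l h => (Prod.mk.inj h).2).map_fun_eq_infinitePi_map (A.measurable_value t)]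
  simp only [A.law_value t]

/-- Wald's identity: the `k`-th arrival contributes `P (k < count) * μ U`, and the tail
probabilities sum to the mean count. -/
lemma lintegral_entrants [IsProbabilityMeasure P] {U : Set ℝ} (hU : MeasurableSet U) (t : ℕ) :
    ∫⁻ ω, (A.entrants U t ω : ℝ≥0∞) ∂P = lam * μ U := by
  have hset : ∀ k, MeasurableSet {ω | k < A.count t ω} := fun k =>
    A.measurable_count t (measurableSet_Ioi (a := k))
  have hcast : ∀ ω, (A.entrants U t ω : ℝ≥0∞)
      = ∑' k, ({ω | k < A.count t ω} ∩ A.value t k ⁻¹' U).indicator 1 ω := by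
    intro ω
    classical
    rw [entrants_eq_countIn, Function.comp_apply, countIn_eq_sum,
      tsum_eq_sum (s := Finset.range (A.count t ω)) fun k hk => ?_]
    · push_cast
      refine Finset.sum_congr rfl fun k hk => ?_
      simp [indicator, Finset.mem_range.1 hk]
    · simp only [Finset.mem_range] at hk
      simp [indicator, hk]
  have hcount : ∀ ω, (A.count t ω : ℝ≥0∞) = ∑' k, {ω | k < A.count t ω}.indicator 1 ω := by
    intro ω
    rw [tsum_eq_sum (s := Finset.range (A.count t ω)) fun k hk => ?_]
    · rw [Finset.sum_congr rfl fun k hk => ?_, Finset.sum_const, Finset.card_range, nsmul_eq_mul,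
        mul_one]
      simp [indicator, Finset.mem_range.1 hk]
    · simp only [Finset.mem_range] at hk
      simp [indicator, hk]
  have hmul : ∀ k, P ({ω | k < A.count t ω} ∩ A.value t k ⁻¹' U)
      = P {ω | k < A.count t ω} * μ U := by
    intro k
    have := ((A.indepFun_count_value t).comp measurable_id
      (measurable_pi_apply k)).measure_inter_preimage_eq_mul (Ioi k) U measurableSet_Ioi hU
    have hlaw : μ U = P (A.value t k ⁻¹' U) :=
      (congrArg (· U) (A.law_value t k)).symm.trans (Measure.map_apply (A.measurable_value t k) hU)
    rw [hlaw]
    exact this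
  simp only [hcast]
  rw [lintegral_tsum fun k => (measurable_one.indicator
    ((hset k).inter (A.measurable_value t k hU))).aemeasurable]
  simp only [lintegral_indicator_one ((hset _).inter (A.measurable_value t _ hU)), hmul]
  rw [ENNReal.tsum_mul_right]
  congr 1
  rw [← lintegral_natCast_poissonMeasure lam, ← A.law_count t,
    lintegral_map .of_discrete (A.measurable_count t)]
  simp only [hcount]
  rw [lintegral_tsum fun k => (measurable_one.indicator (hset k)).aemeasurable]
  simp only [lintegral_indicator_one (hset _)]

lemma isIidInput_entrants [IsProbabilityMeasure P] [IsProbabilityMeasure μ] {U : Set ℝ}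
    (hU : MeasurableSet U) : IsIidInput P (A.entrants U) (lam * μ.real U) := by
  have hlint := A.lintegral_entrants hU 0
  have hm : Measurable fun ω => (A.entrants U 0 ω : ℝ) :=
    measurable_from_nat.comp (A.measurable_entrants hU 0)
  have hint : Integrable (fun ω => (A.entrants U 0 ω : ℝ)) P := by
    refine ⟨hm.aestronglyMeasurable, ?_⟩
    rw [hasFiniteIntegral_iff_ofReal (.of_forall fun ω => Nat.cast_nonneg _)]
    simp only [ENNReal.ofReal_natCast, hlint]
    exact ENNReal.mul_lt_top ENNReal.coe_lt_top (measure_lt_top μ U)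
  refine ⟨A.measurable_entrants hU, A.iIndepFun_entrants hU, fun t => ?_, hint, ?_⟩
  · simp only [entrants_eq_countIn]
    rw [← Measure.map_map (measurable_countIn hU) (A.measurable_countValue t),
      ← Measure.map_map (measurable_countIn hU) (A.measurable_countValue 0), map_countValue,
      map_countValue]
  · rw [integral_eq_lintegral_of_nonneg_ae (.of_forall fun ω => Nat.cast_nonneg _)
      hm.aestronglyMeasurable]
    simp only [ENNReal.ofReal_natCast, hlint, ENNReal.toReal_mul, ENNReal.coe_toReal]
    rfl

/-- With probability `exp (-lam) > 0` nobody arrives at all. -/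
lemma measure_entrants_eq_zero_ne_zero (U : Set ℝ) : P {ω | A.entrants U 0 ω = 0} ≠ 0 := by
  have h : P {ω | A.count 0 ω = 0} = poissonMeasure lam {0} := by
    rw [← A.law_count 0, Measure.map_apply (A.measurable_count 0) (measurableSet_singleton 0)]
    rfl
  refine (lt_of_lt_of_le ?_ (measure_mono (s := {ω | A.count 0 ω = 0}) fun ω hω => ?_)).ne'
  · rw [h, poissonMeasure_singleton]
    simpa using Real.exp_pos _
  · simp only [mem_ofPred_eq] at hω ⊢
    simp [entrants, batch, hω]

end Arrivals

end UnendingAuction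

/-! ### From the auction to queues. -/

namespace UnendingAuction

lemma winner_mem {b : ℝ → ℝ} {l : List ℝ} {v : ℝ} (h : winner b l = some v) : v ∈ l :=
  List.argmax_mem h

/-- If bids are weakly increasing in the value, then a bidder with the highest value wins. -/
lemma le_of_winner_eq_some {b : ℝ → ℝ} (hb : MonotoneOn b (Ici 0)) {l : List ℝ}
    (hl : ∀ w ∈ l, 0 ≤ w) {v w : ℝ} (h : winner b l = some v) (hw : w ∈ l) : w ≤ v := by
  have hle := List.le_of_mem_argmax (f := fun v => toLex (b v, v)) hw h
  rw [Prod.Lex.toLex_le_toLex] at hle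
  rcases hle with hlt | ⟨-, hle⟩
  · by_contra! hc
    exact absurd (hb (hl v (winner_mem h)) (hl w hw) hc.le) (not_le.2 hlt)
  · exact hle

lemma mem_of_mem_afterSale {b : ℝ → ℝ} {l : List ℝ} {v : ℝ} (h : v ∈ afterSale b l) : v ∈ l := by
  unfold afterSale at h
  split at h
  · exact h
  · exact List.mem_of_mem_erase h

-- The winner has the highest value, so it lies in `U` as soon as any member of the pool does;
-- truncated subtraction covers the case of none.
open Classical in
lemma countP_afterSale {b : ℝ → ℝ} (hb : MonotoneOn b (Ici 0)) {l : List ℝ}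
    (hl : ∀ w ∈ l, 0 ≤ w) {U : Set ℝ} (hU : IsUpperSet U) :
    (afterSale b l).countP (· ∈ U) = l.countP (· ∈ U) - 1 := by
  unfold afterSale
  split
  · next h =>
    rw [winner, List.argmax_eq_none] at h
    simp [h]
  · next v h =>
    rw [List.countP_erase]
    by_cases hv : v ∈ U
    · simp [winner_mem h, hv]
    · have h0 : l.countP (· ∈ U) = 0 := by
        rw [List.countP_eq_zero]
        intro w hw
        simpa using fun hwU => hv (hU (le_of_winner_eq_some hb hl h hw) hwU)
      rw [h0, Nat.zero_sub, Nat.zero_sub]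

lemma measureReal_eq_one_of_ae {Ω : Type*} [MeasurableSpace Ω] {P : Measure Ω}
    [IsProbabilityMeasure P] {p : Ω → Prop} (h : ∀ᵐ ω ∂P, p ω) : P.real {ω | p ω} = 1 := by
  rw [measureReal_def, measure_congr (eventuallyEq_univ.2 h), measure_univ, ENNReal.toReal_one]

namespace Arrivals

variable {Ω : Type*} [MeasurableSpace Ω] {P : Measure Ω} {lam : ℝ≥0} {μ : Measure ℝ}
  (A : Arrivals P lam μ) {pool₀ : List ℝ} {b : ℝ → ℝ} {ω : Ω} {U : Set ℝ}

lemma ae_value_nonneg (hμ_neg : μ (Iio 0) = 0) : ∀ᵐ ω ∂P, ∀ t k, 0 ≤ A.value t k ω := by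
  refine ae_all_iff.2 fun t => ae_all_iff.2 fun k => ?_
  have h : ∀ᵐ v ∂(P.map (A.value t k)), 0 ≤ v := by
    rw [A.law_value t k, ae_iff]
    simpa [Iio_def] using hμ_neg
  exact ae_of_ae_map (A.measurable_value t k).aemeasurable h

lemma pool_nonneg (hpool₀ : ∀ v ∈ pool₀, 0 ≤ v) (hω : ∀ t k, 0 ≤ A.value t k ω) (t : ℕ) :
    ∀ v ∈ A.pool pool₀ b t ω, 0 ≤ v := by
  induction t with
  | zero => exact hpool₀
  | succ t ih =>
    intro v hv
    rcases List.mem_append.1 hv with hv | hv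
    · exact ih v (mem_of_mem_afterSale hv)
    · obtain ⟨k, -, rfl⟩ := List.mem_map.1 hv
      exact hω t k

open Classical in
/-- The number of bidders in the pool at round `t` who have a value in the upper set `U`. -/
noncomputable def poolCount (pool₀ : List ℝ) (U : Set ℝ) (t : ℕ) (ω : Ω) : ℕ :=
  queue (pool₀.countP (· ∈ U)) (fun s => A.entrants U s ω) t

-- The bridge to queues. The right side does not mention `b`: monotone bidding functions differ in
-- prices but not in these counts.
open Classical in
lemma countP_pool (hb : MonotoneOn b (Ici 0)) (hpool₀ : ∀ v ∈ pool₀, 0 ≤ v)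
    (hω : ∀ t k, 0 ≤ A.value t k ω) (hU : IsUpperSet U) (t : ℕ) :
    (A.pool pool₀ b t ω).countP (· ∈ U) = A.poolCount pool₀ U t ω := by
  induction t with
  | zero => rfl
  | succ t ih =>
    rw [pool, List.countP_append, countP_afterSale hb (A.pool_nonneg hpool₀ hω t) hU, ih]
    rfl

lemma poolCount_eq_zero_iff (hb : MonotoneOn b (Ici 0)) (hpool₀ : ∀ v ∈ pool₀, 0 ≤ v)
    (hω : ∀ t k, 0 ≤ A.value t k ω) (hU : IsUpperSet U) (t : ℕ) :
    A.poolCount pool₀ U t ω = 0 ↔ ∀ v ∈ A.pool pool₀ b t ω, v ∉ U := by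
  classical
  rw [← A.countP_pool hb hpool₀ hω hU t, List.countP_eq_zero]
  simp

section Measure

variable [IsProbabilityMeasure P] [IsProbabilityMeasure μ]

lemma measurableSet_poolCount_eq_zero (pool₀ : List ℝ) (hU : MeasurableSet U) (t : ℕ) :
    MeasurableSet {ω | A.poolCount pool₀ U t ω = 0} :=
  (A.isIidInput_entrants hU).measurableSet_queue_eq_zero _ t

lemma measurableSet_exists_poolCount_eq_zero (pool₀ : List ℝ) (hU : MeasurableSet U) (T : ℕ) :
    MeasurableSet {ω | ∃ t ≥ T, A.poolCount pool₀ U t ω = 0} :=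
  (A.isIidInput_entrants hU).measurableSet_exists_queue_eq_zero _ T

lemma tendsto_measure_exists_poolCount_eq_zero (pool₀ : List ℝ) (hU : MeasurableSet U)
    (h : 1 < lam * μ.real U) :
    Tendsto (fun T : ℕ => P {ω | ∃ t ≥ T, A.poolCount pool₀ U t ω = 0}) atTop (𝓝 0) :=
  (A.isIidInput_entrants hU).tendsto_measure_exists_queue_eq_zero h _

lemma ae_exists_poolCount_eq_zero (pool₀ : List ℝ) (hU : MeasurableSet U)
    (h : lam * μ.real U ≤ 1) : ∀ᵐ ω ∂P, ∀ T, ∃ t ≥ T, A.poolCount pool₀ U t ω = 0 :=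
  (A.isIidInput_entrants hU).ae_exists_queue_eq_zero (A.measure_entrants_eq_zero_ne_zero U) h _

lemma tendsto_measure_poolCount_eq_zero (pool₀ : List ℝ) (hU : MeasurableSet U)
    (h : lam * μ.real U = 1) :
    Tendsto (fun t : ℕ => P {ω | A.poolCount pool₀ U t ω = 0}) atTop (𝓝 0) :=
  (A.isIidInput_entrants hU).tendsto_measure_queue_eq_zero h _

end Measure

/-! ### Constant bids: winning events, utilities and equilibrium comparisons. -/

/-- The values that, together with the values above them, are not outbid by a bidder with value
`x` who bids `c`. -/
def notOutbid (b : ℝ → ℝ) (x c : ℝ) : Set ℝ :=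
  {v | ∃ u, 0 ≤ u ∧ u ≤ v ∧ ¬(b u < c ∨ b u = c ∧ u < x)}

lemma isUpperSet_notOutbid (b : ℝ → ℝ) (x c : ℝ) : IsUpperSet (notOutbid b x c) :=
  fun _ _ hvw ⟨u, hu, huv, h⟩ => ⟨u, hu, huv.trans hvw, h⟩

lemma measurableSet_notOutbid (b : ℝ → ℝ) (x c : ℝ) : MeasurableSet (notOutbid b x c) :=
  (isUpperSet_notOutbid b x c).ordConnected.measurableSet

/-- For monotone `b` the values that are not outbid already form an upper set among the nonnegative
ones, so the upward closure in `notOutbid` adds nothing there. The closure makes the set upper,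
hence measurable, for every `b`. -/
lemma notMem_notOutbid_iff (hb : MonotoneOn b (Ici 0)) {x c v : ℝ} (hv : 0 ≤ v) :
    v ∉ notOutbid b x c ↔ b v < c ∨ b v = c ∧ v < x := by
  rw [← not_iff_not, not_not]
  refine ⟨fun ⟨u, hu, huv, h⟩ => ?_, fun h => ⟨v, hv, le_rfl, h⟩⟩
  have hle := hb hu hv huv
  push Not at h ⊢
  refine ⟨h.1.trans hle, fun hvc => (h.2 ?_).trans huv⟩
  exact le_antisymm (hle.trans_eq hvc) h.1

lemma wins_const_iff (hb : MonotoneOn b (Ici 0)) (hpool₀ : ∀ v ∈ pool₀, 0 ≤ v)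
    (hω : ∀ t k, 0 ≤ A.value t k ω) (x c : ℝ) (T : ℕ) :
    A.Wins pool₀ b x T (fun _ _ => c) ω
      ↔ ∃ t ≥ T, A.poolCount pool₀ (notOutbid b x c) t ω = 0 := by
  refine exists_congr fun t => and_congr_right fun _ => ?_
  rw [A.poolCount_eq_zero_iff hb hpool₀ hω (isUpperSet_notOutbid b x c)]
  exact forall₂_congr fun v hv =>
    (notMem_notOutbid_iff hb (A.pool_nonneg hpool₀ hω t v hv)).symm

/-- Bidding `c` wins as soon as the pool has no bidder with a value in an upper set `U` such that
`c` outbids all values outside of `U`. -/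
lemma wins_const_of_poolCount_eq_zero (hb : MonotoneOn b (Ici 0)) (hpool₀ : ∀ v ∈ pool₀, 0 ≤ v)
    (hω : ∀ t k, 0 ≤ A.value t k ω) (hU : IsUpperSet U) {x c : ℝ}
    (hc : ∀ v, 0 ≤ v → v ∉ U → b v < c ∨ b v = c ∧ v < x) {t T : ℕ} (ht : T ≤ t)
    (h : A.poolCount pool₀ U t ω = 0) : A.Wins pool₀ b x T (fun _ _ => c) ω :=
  ⟨t, ht, fun v hv => hc v (A.pool_nonneg hpool₀ hω t v hv)
    ((A.poolCount_eq_zero_iff hb hpool₀ hω hU t).1 h v hv)⟩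

lemma utility_of_wins {x : ℝ} {T : ℕ} {c : ℝ} (h : A.Wins pool₀ b x T (fun _ _ => c) ω) :
    A.utility pool₀ b x T (fun _ _ => c) ω = x - c := by
  rw [utility, dif_pos h]

lemma utility_of_not_wins {x : ℝ} {T : ℕ} {β : ℕ → Ω → ℝ} (h : ¬ A.Wins pool₀ b x T β ω) :
    A.utility pool₀ b x T β ω = 0 := by
  rw [utility, dif_neg h]

/-- Every bound on the possible gains from winning bounds the utility. -/
lemma utility_le {x : ℝ} {T : ℕ} {β : ℕ → Ω → ℝ} {B : ℝ} (hB : 0 ≤ B)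
    (h : ∀ t ≥ T, A.Outbids pool₀ b x β t ω → x - β t ω ≤ B) :
    A.utility pool₀ b x T β ω ≤ B := by
  classical
  unfold utility
  split_ifs with hw
  · exact h _ (Nat.find_spec hw).1 (Nat.find_spec hw).2
  · exact hB

/-- Off the null event of a negative value, winning with a constant bid is a queue becoming empty;
this supplies measurability and integrability. -/
lemma utility_const_ae_eq (hμ_neg : μ (Iio 0) = 0) (hpool₀ : ∀ v ∈ pool₀, 0 ≤ v)
    (hb : MonotoneOn b (Ici 0)) (x c : ℝ) (T : ℕ) :
    A.utility pool₀ b x T (fun _ _ => c) =ᵐ[P]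
      {ω | ∃ t ≥ T, A.poolCount pool₀ (notOutbid b x c) t ω = 0}.indicator fun _ => x - c := by
  filter_upwards [A.ae_value_nonneg hμ_neg] with ω hω
  by_cases h : A.Wins pool₀ b x T (fun _ _ => c) ω
  · rw [A.utility_of_wins h, indicator_of_mem]
    exact (A.wins_const_iff hb hpool₀ hω x c T).1 h
  · rw [A.utility_of_not_wins h, indicator_of_notMem]
    exact fun hc => h ((A.wins_const_iff hb hpool₀ hω x c T).2 hc)

lemma measure_wins_const_eq (hμ_neg : μ (Iio 0) = 0) (hpool₀ : ∀ v ∈ pool₀, 0 ≤ v)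
    (hb : MonotoneOn b (Ici 0)) (x c : ℝ) (T : ℕ) :
    P {ω | A.Wins pool₀ b x T (fun _ _ => c) ω}
      = P {ω | ∃ t ≥ T, A.poolCount pool₀ (notOutbid b x c) t ω = 0} := by
  refine measure_congr ?_
  filter_upwards [A.ae_value_nonneg hμ_neg] with ω hω
  exact propext (A.wins_const_iff hb hpool₀ hω x c T)

section Deviation

variable [IsProbabilityMeasure P] [IsProbabilityMeasure μ]

lemma integral_utility_const (hμ_neg : μ (Iio 0) = 0) (hpool₀ : ∀ v ∈ pool₀, 0 ≤ v)
    (hb : MonotoneOn b (Ici 0)) (x c : ℝ) (T : ℕ) :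
    ∫ ω, A.utility pool₀ b x T (fun _ _ => c) ω ∂P
      = P.real {ω | A.Wins pool₀ b x T (fun _ _ => c) ω} * (x - c) := by
  rw [integral_congr_ae (A.utility_const_ae_eq hμ_neg hpool₀ hb x c T), integral_indicator_const _
    (A.measurableSet_exists_poolCount_eq_zero pool₀ (measurableSet_notOutbid b x c) T),
    smul_eq_mul, measureReal_def, measureReal_def, A.measure_wins_const_eq hμ_neg hpool₀ hb]

lemma isStrategy_const (hμ_neg : μ (Iio 0) = 0) (hpool₀ : ∀ v ∈ pool₀, 0 ≤ v)
    (hb : MonotoneOn b (Ici 0)) (info : ℕ → MeasurableSpace Ω) (x : ℝ) {c : ℝ} (hc : 0 ≤ c)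
    (T : ℕ) : A.IsStrategy pool₀ info b x T fun _ _ => c where
  nonneg _ _ := hc
  adapted _ := measurable_const
  integrable := ((integrable_const _).indicator
    (A.measurableSet_exists_poolCount_eq_zero pool₀ (measurableSet_notOutbid b x c) T)).congr
      (A.utility_const_ae_eq hμ_neg hpool₀ hb x c T).symm

/-- In equilibrium there is no gain in the limit from a constant bid `c`. -/
lemma IsSteadyStateEquilibrium.eventually_const_le {info : ℕ → MeasurableSpace Ω}
    (hb : A.IsSteadyStateEquilibrium pool₀ info b) (hμ_neg : μ (Iio 0) = 0)
    (hpool₀ : ∀ v ∈ pool₀, 0 ≤ v) {x c : ℝ} (hx : 0 ≤ x) (hc : 0 ≤ c) {ε : ℝ} (hε : 0 < ε) :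
    ∀ᶠ T : ℕ in atTop, P.real {ω | A.Wins pool₀ b x T (fun _ _ => c) ω} * (x - c)
      ≤ P.real {ω | A.Wins pool₀ b x T (fun _ _ => b x) ω} * (x - b x) + ε := by
  obtain ⟨T₀, hT₀⟩ := hb.no_gain x hx ε hε
  filter_upwards [eventually_ge_atTop T₀] with T hT
  have := hT₀ T hT _ (A.isStrategy_const hμ_neg hpool₀ hb.monotone info x hc T)
  rwa [A.integral_utility_const hμ_neg hpool₀ hb.monotone,
    A.integral_utility_const hμ_neg hpool₀ hb.monotone] at this

/-- If a constant bid `c` wins almost surely, then in equilibrium it is not better than to win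
almost surely with the equilibrium bid. -/
lemma IsSteadyStateEquilibrium.bid_le_of_ae_wins {info : ℕ → MeasurableSpace Ω}
    (hb : A.IsSteadyStateEquilibrium pool₀ info b) (hμ_neg : μ (Iio 0) = 0)
    (hpool₀ : ∀ v ∈ pool₀, 0 ≤ v) {x c : ℝ} (hx : 0 ≤ x) (hc : 0 ≤ c)
    (hwin : ∀ T, ∀ᵐ ω ∂P, A.Wins pool₀ b x T (fun _ _ => b x) ω)
    (hwin_c : ∀ T, ∀ᵐ ω ∂P, A.Wins pool₀ b x T (fun _ _ => c) ω) : b x ≤ c := by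
  refine le_of_forall_pos_le_add fun ε hε => ?_
  obtain ⟨T, hT⟩ := (hb.eventually_const_le A hμ_neg hpool₀ hx hc hε).exists
  rw [measureReal_eq_one_of_ae (hwin T), measureReal_eq_one_of_ae (hwin_c T), one_mul,
    one_mul] at hT
  linarith

/-- If the equilibrium bid wins with vanishing probability, then no constant bid below the value
wins almost surely. -/
lemma IsSteadyStateEquilibrium.le_of_ae_wins {info : ℕ → MeasurableSpace Ω}
    (hb : A.IsSteadyStateEquilibrium pool₀ info b) (hμ_neg : μ (Iio 0) = 0)
    (hpool₀ : ∀ v ∈ pool₀, 0 ≤ v) {x c : ℝ} (hx : 0 ≤ x) (hc : 0 ≤ c)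
    (hlose : Tendsto (fun T : ℕ => P {ω | A.Wins pool₀ b x T (fun _ _ => b x) ω}) atTop (𝓝 0))
    (hwin_c : ∀ T, ∀ᵐ ω ∂P, A.Wins pool₀ b x T (fun _ _ => c) ω) : x ≤ c := by
  have hlim : Tendsto (fun T : ℕ =>
      P.real {ω | A.Wins pool₀ b x T (fun _ _ => b x) ω} * (x - b x)) atTop (𝓝 0) := by
    simpa [measureReal_def] using
        ((ENNReal.tendsto_toReal ENNReal.zero_ne_top).comp hlose).mul_const (x - b x)
  refine le_of_forall_pos_le_add fun ε hε => ?_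
  have hε2 : 0 < ε / 2 := half_pos hε
  obtain ⟨T, hT, hT'⟩ := ((hb.eventually_const_le A hμ_neg hpool₀ hx hc hε2).and
    (hlim.eventually_lt_const hε2)).exists
  rw [measureReal_eq_one_of_ae (hwin_c T), one_mul] at hT
  linarith

end Deviation

end Arrivals

end UnendingAuction

/-! ### The critical value and the posted-price bid. -/

namespace UnendingAuction

lemma measureReal_Ioi_eq_one_sub_cdf (μ : Measure ℝ) [IsProbabilityMeasure μ] (y : ℝ) :
    μ.real (Ioi y) = 1 - cdf μ y := by
  rw [cdf_eq_real, ← compl_Iic, probReal_compl_eq_one_sub measurableSet_Iic]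

lemma measureReal_Ici_eq_one_sub_cdf {μ : Measure ℝ} [IsProbabilityMeasure μ]
    (hμ_atom : ∀ x, μ {x} = 0) (y : ℝ) : μ.real (Ici y) = 1 - cdf μ y := by
  have : NullSingletonClass μ := ⟨hμ_atom⟩
  rw [← measureReal_Ioi_eq_one_sub_cdf, measureReal_congr Ioi_ae_eq_Ici]

section Price

variable {lam : ℝ≥0} {μ : Measure ℝ} [IsProbabilityMeasure μ] {q : ℝ}

lemma pos_of_cdf_eq (hlam : 1 < lam) (hμ_atom : ∀ x, μ {x} = 0) (hμ_neg : μ (Iio 0) = 0)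
    (hq : cdf μ q = ((lam : ℝ) - 1) / lam) : 0 < q := by
  have hlam' : (1 : ℝ) < lam := by exact_mod_cast hlam
  by_contra! hc
  have h0 : cdf μ 0 = 0 := by
    rw [cdf_eq_real, measureReal_def, ← Iio_union_right, measure_union_null hμ_neg (hμ_atom 0),
      ENNReal.toReal_zero]
  have h1 := monotone_cdf μ hc
  rw [h0, hq] at h1
  have : 0 < ((lam : ℝ) - 1) / lam := div_pos (by linarith) (by linarith)
  linarith

lemma lam_mul_measureReal_Ioi_eq_one (hlam : 1 < lam) (hq : cdf μ q = ((lam : ℝ) - 1) / lam) :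
    lam * μ.real (Ioi q) = 1 := by
  have hlam' : (1 : ℝ) < lam := by exact_mod_cast hlam
  rw [measureReal_Ioi_eq_one_sub_cdf, hq]
  field_simp
  ring

lemma lam_mul_measureReal_Ici_le_one (hlam : 1 < lam) (hμ_atom : ∀ x, μ {x} = 0)
    (hq : cdf μ q = ((lam : ℝ) - 1) / lam) {y : ℝ} (hy : q ≤ y) : lam * μ.real (Ici y) ≤ 1 := by
  rw [← lam_mul_measureReal_Ioi_eq_one hlam hq, measureReal_Ici_eq_one_sub_cdf hμ_atom,
    measureReal_Ioi_eq_one_sub_cdf]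
  have := monotone_cdf μ hy
  gcongr

/-- Strictness comes from uniqueness of `q`: the c.d.f. cannot be flat just to the left of `q`. -/
lemma one_lt_lam_mul_measureReal_Ici (hlam : 1 < lam) (hμ_atom : ∀ x, μ {x} = 0)
    (hq : cdf μ q = ((lam : ℝ) - 1) / lam)
    (hq_unique : ∀ y, cdf μ y = ((lam : ℝ) - 1) / lam → y = q) {y : ℝ} (hy : y < q) :
    1 < lam * μ.real (Ici y) := by
  have hlam' : (0 : ℝ) < lam := by exact_mod_cast one_pos.trans hlam
  rw [← lam_mul_measureReal_Ioi_eq_one hlam hq, measureReal_Ici_eq_one_sub_cdf hμ_atom,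
    measureReal_Ioi_eq_one_sub_cdf]
  have hlt : cdf μ y < cdf μ q := (monotone_cdf μ hy.le).lt_of_ne fun h =>
    hy.ne (hq_unique y (h.trans hq))
  exact mul_lt_mul_of_pos_left (by linarith) hlam'

end Price

lemma monotone_postedPriceBid (p : ℝ) : Monotone (postedPriceBid p) := by
  intro x y h
  unfold postedPriceBid
  split_ifs <;> linarith

lemma differentiableAt_postedPriceBid {p x : ℝ} (h : x ≠ p) :
    DifferentiableAt ℝ (postedPriceBid p) x := by
  rcases h.lt_or_gt with h | h
  · refine differentiableAt_id.congr_of_eventuallyEq ?_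
    filter_upwards [eventually_lt_nhds h] with y hy
    simp [postedPriceBid, hy]
  · refine (differentiableAt_const p).congr_of_eventuallyEq ?_
    filter_upwards [eventually_gt_nhds h] with y hy
    simp [postedPriceBid, hy.le]

/-! ### Who wins, and existence of the equilibrium. -/

namespace Arrivals

variable {Ω : Type*} [MeasurableSpace Ω] {P : Measure Ω} [IsProbabilityMeasure P] {lam : ℝ≥0}
  {μ : Measure ℝ} [IsProbabilityMeasure μ] (A : Arrivals P lam μ) {pool₀ : List ℝ} {b : ℝ → ℝ}
  {info : ℕ → MeasurableSpace Ω} {q : ℝ}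

/-- A constant bid that outbids all values outside of an upper set that receives at most one
entrant per round on average wins almost surely. -/
lemma ae_wins_const (hμ_neg : μ (Iio 0) = 0) (hpool₀ : ∀ v ∈ pool₀, 0 ≤ v)
    (hb : MonotoneOn b (Ici 0)) {U : Set ℝ} (hU : IsUpperSet U) (hlamU : lam * μ.real U ≤ 1)
    {x c : ℝ} (hc : ∀ v, 0 ≤ v → v ∉ U → b v < c ∨ b v = c ∧ v < x) (T : ℕ) :
    ∀ᵐ ω ∂P, A.Wins pool₀ b x T (fun _ _ => c) ω := by
  filter_upwards [A.ae_value_nonneg hμ_neg,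
    A.ae_exists_poolCount_eq_zero pool₀ hU.ordConnected.measurableSet hlamU] with ω hω h
  obtain ⟨t, ht, h0⟩ := h T
  exact A.wins_const_of_poolCount_eq_zero hb hpool₀ hω hU hc ht h0

/-- A bidder wins almost surely with her own bid, or with that of a lower type, if on average at
most one bidder per round arrives who has a value at least that type. -/
lemma ae_wins_of_lam_mul_le_one (hμ_neg : μ (Iio 0) = 0) (hpool₀ : ∀ v ∈ pool₀, 0 ≤ v)
    (hb : MonotoneOn b (Ici 0)) {x y : ℝ} (hy : 0 ≤ y) (hyx : y ≤ x)
    (h : lam * μ.real (Ici y) ≤ 1) (T : ℕ) :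
    ∀ᵐ ω ∂P, A.Wins pool₀ b x T (fun _ _ => b y) ω :=
  A.ae_wins_const hμ_neg hpool₀ hb (isUpperSet_Ici y) h (fun v hv hvy => by
    have hvy' : v < y := by simpa using hvy
    exact (hb hv hy hvy'.le).lt_or_eq.imp_right fun h => ⟨h, hvy'.trans_le hyx⟩) T

/-- A bidder eventually loses with her own bid if on average more than one bidder per round
arrives who has at least her value. -/
lemma tendsto_measure_wins_of_one_lt_lam_mul (hμ_neg : μ (Iio 0) = 0)
    (hpool₀ : ∀ v ∈ pool₀, 0 ≤ v) (hb : MonotoneOn b (Ici 0)) {x : ℝ} (hx : 0 ≤ x)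
    (h : 1 < lam * μ.real (Ici x)) :
    Tendsto (fun T : ℕ => P {ω | A.Wins pool₀ b x T (fun _ _ => b x) ω}) atTop (𝓝 0) := by
  refine tendsto_of_tendsto_of_tendsto_of_le_of_le tendsto_const_nhds
    (A.tendsto_measure_exists_poolCount_eq_zero pool₀ measurableSet_Ici h) (fun _ => zero_le)
    fun T => measure_mono_ae ?_
  filter_upwards [A.ae_value_nonneg hμ_neg] with ω hω
  rintro ⟨t, ht, hout⟩
  refine ⟨t, ht, (A.poolCount_eq_zero_iff hb hpool₀ hω (isUpperSet_Ici x) t).2 fun v hv hvx => ?_⟩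
  rcases hout v hv with hlt | ⟨-, hlt⟩
  · exact absurd (hb hx (A.pool_nonneg hpool₀ hω t v hv) hvx) (not_le.2 hlt)
  · exact absurd hvx (not_le.2 hlt)

/-- The posted-price bidding function is a steady-state equilibrium. -/
theorem isSteadyStateEquilibrium_postedPriceBid (hμ_neg : μ (Iio 0) = 0)
    (hpool₀ : ∀ v ∈ pool₀, 0 ≤ v) (hq0 : 0 < q)
    (hhigh : ∀ y, q ≤ y → lam * μ.real (Ici y) ≤ 1)
    (hlow : ∀ y, y < q → 1 < lam * μ.real (Ici y)) :
    A.IsSteadyStateEquilibrium pool₀ info (postedPriceBid q) where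
  nonneg x hx := by
    unfold postedPriceBid
    split_ifs
    exacts [hx, hq0.le]
  monotone := (monotone_postedPriceBid q).monotoneOn _
  piecewise_differentiable K := (finite_singleton q).subset fun x hx => by
    by_contra hne
    exact hx.2 (differentiableAt_postedPriceBid hne)
  no_gain x hx ε hε := by
    set b := postedPriceBid q with hbdef
    have hb : MonotoneOn b (Ici 0) := (monotone_postedPriceBid q).monotoneOn _
    -- Types below `q` bid their value and earn 0 whether or not they win; the others win surely at
    -- price `q`.
    have hbase : ∀ T, ∫ ω, A.utility pool₀ b x T (fun _ _ => b x) ω ∂P = max (x - q) 0 := by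
      intro T
      rw [A.integral_utility_const hμ_neg hpool₀ hb]
      rcases lt_or_ge x q with h | h
      · rw [max_eq_right (by linarith)]
        simp [hbdef, postedPriceBid, h]
      · rw [measureReal_eq_one_of_ae
          (A.ae_wins_of_lam_mul_le_one hμ_neg hpool₀ hb hx le_rfl (hhigh x h) T),
          max_eq_left (by linarith)]
        simp [hbdef, postedPriceBid, h]
    -- Half of `ε` pays for bids between `y` and `q`, the other half for the rare event that a bid
    -- below `y` wins.
    set y := q - ε / 2 with hy
    have hE := A.tendsto_measure_exists_poolCount_eq_zero pool₀ measurableSet_Ici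
      (hlow y (by linarith))
    have hE' : Tendsto (fun T : ℕ => P.real {ω | ∃ t ≥ T, A.poolCount pool₀ (Ici y) t ω = 0} * x)
        atTop (𝓝 0) := by
      simpa [measureReal_def] using
        ((ENNReal.tendsto_toReal ENNReal.zero_ne_top).comp hE).mul_const x
    obtain ⟨T₀, hT₀⟩ := eventually_atTop.1 (hE'.eventually_lt_const (half_pos hε))
    refine ⟨T₀, fun T hT β hβ => ?_⟩
    have hmeas := A.measurableSet_exists_poolCount_eq_zero pool₀ (measurableSet_Ici (a := y)) T
    have hbound : ∀ᵐ ω ∂P, A.utility pool₀ b x T β ω ≤ (max (x - q) 0 + ε / 2)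
        + {ω | ∃ t ≥ T, A.poolCount pool₀ (Ici y) t ω = 0}.indicator (fun _ => x) ω := by
      filter_upwards [A.ae_value_nonneg hμ_neg] with ω hω
      have hmax : 0 ≤ max (x - q) 0 := le_max_right _ _
      have hmax' : x - q ≤ max (x - q) 0 := le_max_left _ _
      have hind : 0 ≤ {ω | ∃ t ≥ T, A.poolCount pool₀ (Ici y) t ω = 0}.indicator (fun _ => x) ω :=
        indicator_nonneg (fun _ _ => hx) _
      refine A.utility_le (by linarith) fun t ht hout => ?_
      -- A winning bid of at least `y` gains at most `x - y`. A winning bid below `y` means that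
      -- every value in the pool is below `y`; there the crude bound `x` suffices.
      rcases le_or_gt y (β t ω) with hβy | hβy
      · linarith
      · rw [indicator_of_mem]
        · have := hβ.nonneg t ω
          linarith
        · refine ⟨t, ht, (A.poolCount_eq_zero_iff hb hpool₀ hω (isUpperSet_Ici y) t).2
            fun v hv hvy => ?_⟩
          have hbv : b v ≤ β t ω := (hout v hv).elim le_of_lt fun h => h.1.le
          have hyb : y ≤ b v := by
            simp only [hbdef, postedPriceBid]
            split_ifs
            exacts [hvy, by linarith]
          linarith
    rw [hbase]
    have hint : Integrable
        ({ω | ∃ t ≥ T, A.poolCount pool₀ (Ici y) t ω = 0}.indicator fun _ => x) P :=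
      (integrable_const x).indicator hmeas
    calc ∫ ω, A.utility pool₀ b x T β ω ∂P
        ≤ ∫ ω, ((max (x - q) 0 + ε / 2)
          + {ω | ∃ t ≥ T, A.poolCount pool₀ (Ici y) t ω = 0}.indicator (fun _ => x) ω) ∂P :=
          integral_mono_ae hβ.integrable ((integrable_const _).add hint) hbound
      _ = max (x - q) 0 + ε / 2
          + P.real {ω | ∃ t ≥ T, A.poolCount pool₀ (Ici y) t ω = 0} * x := by
          rw [integral_add (integrable_const _) hint, integral_indicator_const _ hmeas]
          simp
      _ ≤ max (x - q) 0 + ε := by linarith [hT₀ T hT]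

/-! ### Properties forced on every equilibrium. -/

namespace IsSteadyStateEquilibrium

variable {A} (hb : A.IsSteadyStateEquilibrium pool₀ info b) (hμ_neg : μ (Iio 0) = 0)
  (hpool₀ : ∀ v ∈ pool₀, 0 ≤ v) (hq0 : 0 < q)

include hb hμ_neg hpool₀ hq0

/-- Both types win surely with their own bids, and `x` also wins surely with the bid of `y`, so
paying more would be a mistake. -/
lemma bid_eq_bid_of_lt (hhigh : ∀ y, q ≤ y → lam * μ.real (Ici y) ≤ 1) {x y : ℝ} (hy : q < y)
    (hyx : y ≤ x) : b x = b y := by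
  have hy0 : 0 ≤ y := (hq0.trans hy).le
  have hx0 : 0 ≤ x := hy0.trans hyx
  refine le_antisymm ?_ (hb.monotone hy0 hx0 hyx)
  exact hb.bid_le_of_ae_wins A hμ_neg hpool₀ hx0 (hb.nonneg y hy0)
    (A.ae_wins_of_lam_mul_le_one hμ_neg hpool₀ hb.monotone hx0 le_rfl (hhigh x (hy.le.trans hyx)))
    (A.ae_wins_of_lam_mul_le_one hμ_neg hpool₀ hb.monotone hy0 hyx (hhigh y hy.le))

/-- Type `x` wins surely and so earns `x - b x`, while bidding 0 always earns at least 0. -/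
lemma bid_le_of_lt (hhigh : ∀ y, q ≤ y → lam * μ.real (Ici y) ≤ 1) {x : ℝ} (hx : q < x) :
    b x ≤ x := by
  have hx0 : 0 ≤ x := (hq0.trans hx).le
  refine le_of_forall_pos_le_add fun ε hε => ?_
  obtain ⟨T, hT⟩ := (hb.eventually_const_le A hμ_neg hpool₀ hx0 le_rfl hε).exists
  rw [measureReal_eq_one_of_ae (A.ae_wins_of_lam_mul_le_one hμ_neg hpool₀ hb.monotone hx0 le_rfl
    (hhigh x hx.le) T), one_mul, sub_zero] at hT
  have : 0 ≤ P.real {ω | A.Wins pool₀ b x T (fun _ _ => 0) ω} * x := by positivity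
  linarith

/-- No bid below `q` outbids all values outside of an upper set that receives at most one entrant
per round on average. -/
lemma le_of_forall_bid_le (hlow : ∀ y, y < q → 1 < lam * μ.real (Ici y)) {U : Set ℝ}
    (hU : IsUpperSet U) (hlamU : lam * μ.real U ≤ 1) {a : ℝ}
    (ha : ∀ v, 0 ≤ v → v ∉ U → b v ≤ a) : q ≤ a := by
  by_contra! hc
  -- With `max a 0 < c < x < q`, type `x` earns nothing in the limit from her own bid, while the bid
  -- `c` wins surely and yields `x - c > 0`.
  obtain ⟨c, hac, hcq⟩ := exists_between (max_lt hc hq0)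
  obtain ⟨x, hcx, hxq⟩ := exists_between hcq
  have hc0 : 0 ≤ c := (le_max_right a 0).trans hac.le
  have hx0 : 0 ≤ x := hc0.trans hcx.le
  refine hcx.not_ge (hb.le_of_ae_wins A hμ_neg hpool₀ hx0 hc0
    (A.tendsto_measure_wins_of_one_lt_lam_mul hμ_neg hpool₀ hb.monotone hx0 (hlow x hxq))
    (A.ae_wins_const hμ_neg hpool₀ hb.monotone hU hlamU fun v hv hvU => Or.inl ?_))
  exact (ha v hv hvU).trans_lt ((le_max_left a 0).trans_lt hac)

/-- In equilibrium all bidders with values above `q` bid `q`. -/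
theorem bid_eq (hhigh : ∀ y, q ≤ y → lam * μ.real (Ici y) ≤ 1)
    (hlow : ∀ y, y < q → 1 < lam * μ.real (Ici y)) {x : ℝ} (hx : q < x) : b x = q := by
  have hconst : ∀ y, q < y → b y = b x := fun y hy => by
    rcases le_total x y with h | h
    · exact hb.bid_eq_bid_of_lt hμ_neg hpool₀ hq0 hhigh hx h
    · exact (hb.bid_eq_bid_of_lt hμ_neg hpool₀ hq0 hhigh hy h).symm
  refine le_antisymm (le_of_forall_gt_imp_ge_of_dense fun y hy => ?_) ?_
  · exact (hconst y hy).symm.le.trans (hb.bid_le_of_lt hμ_neg hpool₀ hq0 hhigh hy)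
  -- The empty upper set suffices because no type at all bids more than the common bid above `q`.
  · refine hb.le_of_forall_bid_le hμ_neg hpool₀ hq0 hlow isUpperSet_empty (by simp) fun v hv _ => ?_
    exact (hb.monotone hv (hv.trans (le_max_left v x)) (le_max_left v x)).trans_eq
      (hconst _ (hx.trans_le (le_max_right v x)))

/-- In equilibrium the bids tend to `q` as the value approaches `q` from below. -/
theorem tendsto_bid (hhigh : ∀ y, q ≤ y → lam * μ.real (Ici y) ≤ 1)
    (hlow : ∀ y, y < q → 1 < lam * μ.real (Ici y)) : Tendsto b (𝓝[<] q) (𝓝 q) := by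
  have hnonneg : ∀ᶠ v in 𝓝[<] q, 0 ≤ v :=
    mem_nhdsWithin_of_mem_nhds (Ici_mem_nhds hq0)
  refine tendsto_order.2 ⟨fun a ha => ?_, fun a ha => ?_⟩
  · have hex : ∃ v, 0 ≤ v ∧ v < q ∧ a < b v := by
      by_contra! hc
      -- If all types below `q` bid at most `a < q`, overbidding `a` wins whenever no type in `Ici
      -- q` is present, which happens infinitely often.
      exact ha.not_ge (hb.le_of_forall_bid_le hμ_neg hpool₀ hq0 hlow (isUpperSet_Ici q)
        (hhigh q le_rfl) fun v hv hvq => hc v hv (by simpa using hvq))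
    obtain ⟨v, hv0, hvq, hav⟩ := hex
    filter_upwards [mem_nhdsWithin_of_mem_nhds (Ioi_mem_nhds hvq)] with w hw
    exact hav.trans_le (hb.monotone hv0 (hv0.trans hw.le) hw.le)
  · filter_upwards [hnonneg, self_mem_nhdsWithin] with v hv hvq
    have hvq' : v ≤ q + 1 := (mem_Iio.1 hvq).le.trans (by linarith)
    refine lt_of_le_of_lt ?_ ha
    rw [← hb.bid_eq hμ_neg hpool₀ hq0 hhigh hlow (lt_add_one q)]
    exact hb.monotone hv (hv.trans hvq') hvq'

/-- An individually rational equilibrium is dominated by posted-price bidding. -/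
theorem le_postedPriceBid (hhigh : ∀ y, q ≤ y → lam * μ.real (Ici y) ≤ 1)
    (hlow : ∀ y, y < q → 1 < lam * μ.real (Ici y)) (hir : ∀ x, 0 ≤ x → b x ≤ x) {x : ℝ}
    (hx : 0 ≤ x) : b x ≤ postedPriceBid q x := by
  unfold postedPriceBid
  split_ifs with h
  · exact hir x hx
  · have hx1 : x ≤ x + 1 := by linarith
    rw [← hb.bid_eq hμ_neg hpool₀ hq0 hhigh hlow (show q < x + 1 by linarith)]
    exact hb.monotone hx (hx.trans hx1) hx1

/-- In equilibrium the price is `q` with a probability that tends to `1`. -/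
theorem tendsto_measure_price_eq (hhigh : ∀ y, q ≤ y → lam * μ.real (Ici y) ≤ 1)
    (hlow : ∀ y, y < q → 1 < lam * μ.real (Ici y)) (hcrit : lam * μ.real (Ioi q) = 1) :
    Tendsto (fun t : ℕ => P {ω | A.price pool₀ b t ω = some q}) atTop (𝓝 1) := by
  -- The types above `q` arrive at the critical rate 1: although they are absent infinitely often,
  -- at a given late round one is probably present.
  have hempty := A.tendsto_measure_poolCount_eq_zero pool₀ measurableSet_Ioi hcrit
  have hlim : Tendsto (fun t : ℕ => P {ω | A.poolCount pool₀ (Ioi q) t ω = 0}ᶜ) atTop (𝓝 1) := by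
    simp only [prob_compl_eq_one_sub (A.measurableSet_poolCount_eq_zero pool₀ measurableSet_Ioi _)]
    simpa using ENNReal.Tendsto.sub tendsto_const_nhds hempty (Or.inl ENNReal.one_ne_top)
  refine tendsto_of_tendsto_of_tendsto_of_le_of_le hlim tendsto_const_nhds
    (fun t => measure_mono_ae ?_) fun t => prob_le_one
  filter_upwards [A.ae_value_nonneg hμ_neg] with ω hω hne
  change ¬ _ = 0 at hne
  rw [A.poolCount_eq_zero_iff hb.monotone hpool₀ hω (isUpperSet_Ioi q)] at hne
  push Not at hne
  obtain ⟨w, hw, hqw⟩ := hne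
  obtain ⟨v, hv⟩ : ∃ v, winner b (A.pool pool₀ b t ω) = some v := by
    refine Option.ne_none_iff_exists'.1 fun hnone => ?_
    rw [winner, List.argmax_eq_none] at hnone
    simp [hnone] at hw
  have hwv := le_of_winner_eq_some hb.monotone (A.pool_nonneg hpool₀ hω t) hv hw
  change (winner b _).map b = some q
  rw [hv, Option.map_some, hb.bid_eq hμ_neg hpool₀ hq0 hhigh hlow (lt_of_lt_of_le hqw hwv)]

end IsSteadyStateEquilibrium

end Arrivals

end UnendingAuction

theorem mainTheorem2 {Ω : Type*} [MeasurableSpace Ω] (P : Measure Ω) [IsProbabilityMeasure P]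
    (lam : ℝ≥0) (hlam : 1 < lam)
    (μ : Measure ℝ) [IsProbabilityMeasure μ] (hμ_atom : ∀ x, μ {x} = 0) (hμ_neg : μ (Iio 0) = 0)
    (A : UnendingAuction.Arrivals P lam μ)
    (pool₀ : List ℝ) (hpool₀ : ∀ v ∈ pool₀, 0 ≤ v)
    (info : ℕ → MeasurableSpace Ω) (hinfo : ∀ t, info t ≤ ‹MeasurableSpace Ω›)
    (q : ℝ) (hq : cdf μ q = ((lam : ℝ) - 1) / lam)
    (hq_unique : ∀ y, cdf μ y = ((lam : ℝ) - 1) / lam → y = q) :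
    A.IsSteadyStateEquilibrium pool₀ info (UnendingAuction.postedPriceBid q) ∧
    ∀ b : ℝ → ℝ, A.IsSteadyStateEquilibrium pool₀ info b →
      (∀ x, q < x → b x = q) ∧
      Tendsto b (𝓝[<] q) (𝓝 q) ∧
      ((∀ x, 0 ≤ x → b x ≤ x) → ∀ x, 0 ≤ x → b x ≤ UnendingAuction.postedPriceBid q x) ∧
      (∀ x, q < x → ∀ T : ℕ, ∀ᵐ ω ∂P, A.Wins pool₀ b x T (fun _ _ => b x) ω) ∧
      (∀ x, 0 ≤ x → x < q →
        Tendsto (fun T : ℕ => P {ω | A.Wins pool₀ b x T (fun _ _ => b x) ω}) atTop (𝓝 0)) ∧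
      Tendsto (fun t : ℕ => P {ω | A.price pool₀ b t ω = some q}) atTop (𝓝 1) := by
  have hq0 := UnendingAuction.pos_of_cdf_eq hlam hμ_atom hμ_neg hq
  have hcrit := UnendingAuction.lam_mul_measureReal_Ioi_eq_one hlam hq
  have hhigh : ∀ y, q ≤ y → lam * μ.real (Ici y) ≤ 1 := fun _ =>
    UnendingAuction.lam_mul_measureReal_Ici_le_one hlam hμ_atom hq
  have hlow : ∀ y, y < q → 1 < lam * μ.real (Ici y) := fun _ =>
    UnendingAuction.one_lt_lam_mul_measureReal_Ici hlam hμ_atom hq hq_unique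
  refine ⟨A.isSteadyStateEquilibrium_postedPriceBid hμ_neg hpool₀ hq0 hhigh hlow, fun b hb => ?_⟩
  refine ⟨fun x hx => hb.bid_eq hμ_neg hpool₀ hq0 hhigh hlow hx,
    hb.tendsto_bid hμ_neg hpool₀ hq0 hhigh hlow,
    fun hir x hx => hb.le_postedPriceBid hμ_neg hpool₀ hq0 hhigh hlow hir hx,
    fun x hx => ?_, fun x hx hxq => ?_,
    hb.tendsto_measure_price_eq hμ_neg hpool₀ hq0 hhigh hlow hcrit⟩
  · exact A.ae_wins_of_lam_mul_le_one hμ_neg hpool₀ hb.monotone (hq0.trans hx).le le_rfl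
      (hhigh x hx.le)
  · exact A.tendsto_measure_wins_of_one_lt_lam_mul hμ_neg hpool₀ hb.monotone hx (hlow x hxq)
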